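/- Let $q$ be a nonzero complex number with a fixed square root $q^{1/2}$. All algebras are unital and associative over $\mathbb C$; $p$ denotes the parity of a homogeneous element of a $\mathbb Z_2$-graded space, and the tensor product of two superalgebras carries the product $(a_1\otimes a_2)(a_3\otimes a_4)=(-1)^{p(a_2)p(a_3)}a_1a_3\otimes a_2a_4$ on homogeneous elements. **The quantum superspace.** $\mathcal X=\mathcal O(SP_q^{1|2})$ is the superalgebra generated by an even element $x$ and odd elements $\xi,\eta$ with the defining relations $$x\xi=q\,\xi x,\qquad x\eta=q^{-1}\eta x,\qquad \eta\xi=-q^2\xi\eta+q^{1/2}(1-q)x^2,\qquad \xi^2=0=\eta^2 .$$ **The quantum supergroup.** $\mathcal A=\mathcal O(SP_q(1|2))$ is the superalgebra generated by even elements $a,b,c,d$ and odd elements $\alpha,\delta$ with the defining relations $$\begin{aligned} &ab=q^2ba,\quad ac=q^2ca,\quad a\alpha=q\,\alpha a,\quad a\delta=q\,\delta a+(q-q^{-1})\alpha c,\\ &ad=da+(q-q^{-1})\big[(1+q^{-1})bc+q^{-1/2}\alpha\delta\big],\\ &bc=cb,\quad bd=q^2db,\quad b\alpha=q^{-1}\alpha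 b,\quad b\delta=q\,\delta b,\quad cd=q^2dc,\quad c\alpha=q^{-1}\alpha c,\quad c\delta=q\,\delta c,\\ &d\alpha=q^{-1}\alpha d+(q^{-1}-q)\delta b,\quad d\delta=q^{-1}\delta d,\quad \alpha\delta=-q\,\delta\alpha+q^{1/2}(q-q^{-1})bc,\\ &\alpha^2=q^{1/2}(q-1)ba,\quad \delta^2=q^{1/2}(q-1)dc,\qquad ad-q\,bc-q^{1/2}\alpha\delta=1 . \end{aligned}$$ Put $\gamma=q^{1/2}\delta a-q^{-1/2}c\alpha$, $e=1-q^{-1/2}\alpha\delta+(q-1)bc$, $\beta=q^{1/2}b\delta-q^{-1/2}\alpha d$ and $$T=(t_{ij})=\begin{pmatrix}a&\alpha&b\\ \gamma&e&\beta\\ c&\delta&d\end{pmatrix}.$$ $\mathcal A$ has the algebra homomorphisms $\Delta:\mathcal A\to\mathcal A\otimes\mathcal A$ and $\epsilon:\mathcal A\to\mathbb C$ with $\Delta(t_{ij})=\sum_k t_{ik}\otimes t_{kj}$ and $\epsilon(t_{ij})=\delta_{ij}$, and it coacts on $\mathcal X$ by the algebra homomorphism $\delta_L:\mathcal X\to\mathcal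 A\otimes\mathcal X$ with $\delta_L(X_i)=\sum_k t_{ik}\otimes X_k$, where $(X_1,X_2,X_3)=(\xi,x,\eta)$. **Calculi.** A $\mathbb Z_2$-graded first-order differential calculus over $\mathcal X$ is a $\mathbb Z_2$-graded $\mathcal X$-bimodule $\Gamma$ with a linear map $\mathsf d:\mathcal X\to\Gamma$ of grade one such that $\mathsf d(fg)=(\mathsf df)\,g+(-1)^{p(f)}f\,\mathsf dg$ for homogeneous $f$ and all $g$, and such that $\Gamma$ is the linear span of the elements $u\cdot\mathsf dv\cdot w$ with $u,v,w\in\mathcal X$. Let $\mathcal A\otimes\Gamma$ be the bimodule over $\mathcal A\otimes\mathcal X$ with $(a\otimes u)(b\otimes w)=(-1)^{p(u)p(b)}ab\otimes uw$ and $(a\otimes w)(b\otimes u)=(-1)^{p(w)p(b)}ab\otimes wu$ on homogeneous elements ($a,b\in\mathcal A$, $u\in\mathcal X$, $w\in\Gamma$). The calculus is left-covariant with respect to $\mathcal A$ if $\delta_L$ is a left coaction of $\mathcal A$ on $\mathcal X$ and there is a left coaction $\Delta_L:\Gamma\to\mathcal A\otimes\Gamma$ of $\mathcal A$ on $\Gamma$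 (that is, $\Delta_L$ is linear with $(\mathrm{id}\otimes\Delta_L)\Delta_L=(\Delta\otimes\mathrm{id})\Delta_L$ and $(\epsilon\otimes\mathrm{id})\Delta_L=\mathrm{id}$) such that $\Delta_L(uw)=\delta_L(u)\Delta_L(w)$ and $\Delta_L(wu)=\Delta_L(w)\delta_L(u)$ for all $u\in\mathcal X$, $w\in\Gamma$, and $\Delta_L\circ\mathsf d=(\tau\otimes\mathsf d)\circ\delta_L$, where $\tau(a)=(-1)^{p(a)}a$ for homogeneous $a\in\mathcal A$. **Proposition.** There exists a left-covariant $\mathbb Z_2$-graded first-order differential calculus $(\Gamma_+,\mathsf d)$ over $\mathcal X=\mathcal O(SP_q^{1|2})$ with respect to $\mathcal A=\mathcal O(SP_q(1|2))$ such that $\{\mathsf dx,\mathsf d\xi,\mathsf d\eta\}$ is a free right $\mathcal X$-module basis of $\Gamma_+$ and $$\begin{aligned} x\,\mathsf dx&=q\,\mathsf dx\,x+q^{1/2}(q^2-1)\,\mathsf d\eta\,\xi, & x\,\mathsf d\xi&=q\,\mathsf d\xi\,x+(q^2-1)\,\mathsf dx\,\xi, & x\,\mathsf d\eta&=q\,\mathsf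 d\eta\,x,\\ \xi\,\mathsf dx&=-q\,\mathsf dx\,\xi, & \xi\,\mathsf d\xi&=\mathsf d\xi\,\xi, & \xi\,\mathsf d\eta&=q^2\,\mathsf d\eta\,\xi,\\ \eta\,\mathsf dx&=-q\,\mathsf dx\,\eta+(1-q^2)\,\mathsf d\eta\,x, & \eta\,\mathsf d\xi&=q^2\,\mathsf d\xi\,\eta+(1-q^2)\big[(1+q)\,\mathsf d\eta\,\xi-q^{1/2}\,\mathsf dx\,x\big], & \eta\,\mathsf d\eta&=\mathsf d\eta\,\eta . \end{aligned}$$ -/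

import Mathlib

open scoped TensorProduct DirectSum RightActions

namespace QSP

/-! ### Superalgebras over `ℂ` given by their parity automorphism -/

section Parity
variable {A : Type} [Ring A] [Algebra ℂ A]

/-- For an involutive algebra automorphism `τ`, the homogeneous part of degree `i : ZMod 2`, that is
the eigenspace of `τ` for the eigenvalue `(-1) ^ i`. -/
def parityPart (τ : A →ₐ[ℂ] A) (i : ZMod 2) : Submodule ℂ A :=
  LinearMap.ker (τ.toLinearMap - (-1 : ℂ) ^ i.val • LinearMap.id)

theorem mem_parityPart {τ : A →ₐ[ℂ] A} {i : ZMod 2} {a : A} :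
    a ∈ parityPart τ i ↔ τ a = (-1 : ℂ) ^ i.val • a := by
  simp [parityPart, sub_eq_zero]

theorem parity_add (i j : ZMod 2) : (-1 : ℂ) ^ (i + j).val = (-1) ^ i.val * (-1) ^ j.val := by
  rw [← pow_add, ZMod.val_add, ← neg_one_pow_eq_pow_mod_two]

theorem zmod_two_cases (i : ZMod 2) : i = 0 ∨ i = 1 := by
  revert i; decide

theorem evenPart_mem {τ : A →ₐ[ℂ] A} (h : ∀ a, τ (τ a) = a) (a : A) :
    ((1 / 2 : ℂ) • (LinearMap.id + τ.toLinearMap) : A →ₗ[ℂ] A) a ∈ parityPart τ 0 := by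
  simp [mem_parityPart, h, add_comm]

theorem oddPart_mem {τ : A →ₐ[ℂ] A} (h : ∀ a, τ (τ a) = a) (a : A) :
    ((1 / 2 : ℂ) • (LinearMap.id - τ.toLinearMap) : A →ₗ[ℂ] A) a ∈ parityPart τ 1 := by
  rw [mem_parityPart]
  simp [ZMod.val_one, h, ← smul_neg]

/-- The `ℤ₂`-grading of an algebra defined by an involutive automorphism. -/
@[reducible] noncomputable def gradedOfInvolution (τ : A →ₐ[ℂ] A) (h : ∀ a, τ (τ a) = a) :
    GradedAlgebra (parityPart τ) where
  one_mem := by simp [mem_parityPart]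
  mul_mem := by
    intro i j a b ha hb
    rw [mem_parityPart] at *
    rw [map_mul, ha, hb, parity_add, smul_mul_smul_comm]
  toDecomposition := DirectSum.Decomposition.ofLinearMap _
    (DirectSum.lof ℂ _ (fun i => parityPart τ i) 0 ∘ₗ
        LinearMap.codRestrict _ ((1 / 2 : ℂ) • (LinearMap.id + τ.toLinearMap))
          (evenPart_mem h) +
      DirectSum.lof ℂ _ (fun i => parityPart τ i) 1 ∘ₗ
        LinearMap.codRestrict _ ((1 / 2 : ℂ) • (LinearMap.id - τ.toLinearMap))
          (oddPart_mem h))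
    (by
      ext a
      simp [DirectSum.coeLinearMap_lof]
      module)
    (by
      ext i a : 2
      obtain ⟨a, ha⟩ := a
      have ha' := mem_parityPart.1 ha
      rcases zmod_two_cases i with rfl | rfl
      · have h0 : LinearMap.codRestrict (parityPart τ 0) ((1 / 2 : ℂ) • (LinearMap.id + τ.toLinearMap))
          (evenPart_mem h) a = ⟨a, ha⟩ := by
          ext; simp at ha'; simp [ha']; module
        have h1 : LinearMap.codRestrict (parityPart τ 1) ((1 / 2 : ℂ) • (LinearMap.id - τ.toLinearMap))
          (oddPart_mem h) a = 0 := by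
          ext; simp at ha'; simp [ha']
        simp only [LinearMap.comp_apply, LinearMap.add_apply, DirectSum.coeLinearMap_lof, h0, h1,
          map_zero, add_zero, LinearMap.id_apply]
      · have h0 : LinearMap.codRestrict (parityPart τ 0) ((1 / 2 : ℂ) • (LinearMap.id + τ.toLinearMap))
          (evenPart_mem h) a = 0 := by
          ext; simp [ZMod.val_one] at ha'; simp [ha']
        have h1 : LinearMap.codRestrict (parityPart τ 1) ((1 / 2 : ℂ) • (LinearMap.id - τ.toLinearMap))
          (oddPart_mem h) a = ⟨a, ha⟩ := by
          ext; simp [ZMod.val_one] at ha'; simp [ha']; module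
        simp only [LinearMap.comp_apply, LinearMap.add_apply, DirectSum.coeLinearMap_lof, h0, h1,
          map_zero, zero_add, LinearMap.id_apply])
end Parity

section Tensor
variable {A B : Type} [Ring A] [Algebra ℂ A] [Ring B] [Algebra ℂ B]
  (𝒜 : ZMod 2 → Submodule ℂ A) (ℬ : ZMod 2 → Submodule ℂ B) [GradedAlgebra 𝒜] [GradedAlgebra ℬ]

/-- The product of the graded tensor product: `(x ⊗ b)(a ⊗ y) = (-1)^(p(b)p(a)) xa ⊗ by`. -/
theorem tmul_mul_tmul {i j : ZMod 2} {b : B} {a : A} (hb : b ∈ ℬ i) (ha : a ∈ 𝒜 j) (x : A)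
    (y : B) : (x ᵍ⊗ₜ[ℂ] b : 𝒜 ᵍ⊗[ℂ] ℬ) * (a ᵍ⊗ₜ[ℂ] y) =
      ((-1 : ℂ) ^ (i.val * j.val)) • ((x * a) ᵍ⊗ₜ[ℂ] (b * y) : 𝒜 ᵍ⊗[ℂ] ℬ) := by
  have := GradedTensorProduct.tmul_coe_mul_coe_tmul 𝒜 ℬ x ⟨b, hb⟩ ⟨a, ha⟩ y
  simp only at this
  rw [this]
  rcases zmod_two_cases i with rfl | rfl <;> rcases zmod_two_cases j with rfl | rfl <;>
    simp [ZMod.val_one]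

variable {𝒜 ℬ}

theorem one_tmul_one : (1 : 𝒜 ᵍ⊗[ℂ] ℬ) = (1 : A) ᵍ⊗ₜ[ℂ] (1 : B) := rfl
theorem tmul_add' (x : A) (y z : B) :
    (x ᵍ⊗ₜ[ℂ] (y + z) : 𝒜 ᵍ⊗[ℂ] ℬ) = x ᵍ⊗ₜ[ℂ] y + x ᵍ⊗ₜ[ℂ] z := TensorProduct.tmul_add _ _ _
theorem add_tmul' (x w : A) (y : B) :
    ((x + w) ᵍ⊗ₜ[ℂ] y : 𝒜 ᵍ⊗[ℂ] ℬ) = x ᵍ⊗ₜ[ℂ] y + w ᵍ⊗ₜ[ℂ] y := TensorProduct.add_tmul _ _ _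
theorem tmul_sub' (x : A) (y z : B) :
    (x ᵍ⊗ₜ[ℂ] (y - z) : 𝒜 ᵍ⊗[ℂ] ℬ) = x ᵍ⊗ₜ[ℂ] y - x ᵍ⊗ₜ[ℂ] z := TensorProduct.tmul_sub _ _ _
theorem sub_tmul' (x w : A) (y : B) :
    ((x - w) ᵍ⊗ₜ[ℂ] y : 𝒜 ᵍ⊗[ℂ] ℬ) = x ᵍ⊗ₜ[ℂ] y - w ᵍ⊗ₜ[ℂ] y := TensorProduct.sub_tmul _ _ _
theorem tmul_smul' (t : ℂ) (x : A) (y : B) :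
    (x ᵍ⊗ₜ[ℂ] (t • y) : 𝒜 ᵍ⊗[ℂ] ℬ) = t • (x ᵍ⊗ₜ[ℂ] y) := TensorProduct.tmul_smul _ _ _
theorem smul_tmul' (t : ℂ) (x : A) (y : B) :
    ((t • x) ᵍ⊗ₜ[ℂ] y : 𝒜 ᵍ⊗[ℂ] ℬ) = t • (x ᵍ⊗ₜ[ℂ] y) := TensorProduct.smul_tmul' _ _ _

theorem tmul_zero' (x : A) : (x ᵍ⊗ₜ[ℂ] (0 : B) : 𝒜 ᵍ⊗[ℂ] ℬ) = 0 := TensorProduct.tmul_zero _ _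

end Tensor

/-- The deformation parameter `q`, for a chosen square root `r = q^{1/2}`. -/
def q (r : ℂˣ) : ℂ := (r : ℂ) ^ 2

theorem q_ne_zero (r : ℂˣ) : q r ≠ 0 := pow_ne_zero _ r.ne_zero

/-- The parity of the index `i`: the `i`-th coordinate has parity `idx i`, and `t_ij` has parity
`idx i + idx j`. -/
def idx : Fin 3 → ZMod 2 := ![1, 0, 1]

/-! ### The quantum symplectic superspace -/

open FreeAlgebra (ι)

/-- The defining relations of `𝒪(SP_q^{1|2})`; the generators with index `0`, `1`, `2` are `ξ`, `x`
and `η`. -/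
inductive SpaceRel (r : ℂˣ) : FreeAlgebra ℂ (Fin 3) → FreeAlgebra ℂ (Fin 3) → Prop
  | x_xi : SpaceRel r (ι ℂ 1 * ι ℂ 0) (q r • (ι ℂ 0 * ι ℂ 1))
  | x_eta : SpaceRel r (ι ℂ 1 * ι ℂ 2) ((q r)⁻¹ • (ι ℂ 2 * ι ℂ 1))
  | eta_xi : SpaceRel r (ι ℂ 2 * ι ℂ 0)
      (-(q r) ^ 2 • (ι ℂ 0 * ι ℂ 2) + ((r : ℂ) * (1 - q r)) • (ι ℂ 1 * ι ℂ 1))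
  | xi_xi : SpaceRel r (ι ℂ 0 * ι ℂ 0) 0
  | eta_eta : SpaceRel r (ι ℂ 2 * ι ℂ 2) 0

/-- The algebra `𝒪(SP_q^{1|2})` of polynomials on the quantum symplectic superspace. -/
def SPSpace (r : ℂˣ) : Type := RingQuot (SpaceRel r)

noncomputable instance (r : ℂˣ) : Ring (SPSpace r) := inferInstanceAs (Ring (RingQuot (SpaceRel r)))
noncomputable instance (r : ℂˣ) : Algebra ℂ (SPSpace r) :=
  inferInstanceAs (Algebra ℂ (RingQuot (SpaceRel r)))

namespace SPSpace
variable {r : ℂˣ} {B : Type} [Ring B] [Algebra ℂ B]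

/-- The quotient map from the free algebra. -/
noncomputable def mk (r : ℂˣ) : FreeAlgebra ℂ (Fin 3) →ₐ[ℂ] SPSpace r :=
  RingQuot.mkAlgHom ℂ (SpaceRel r)

theorem mk_rel {u v : FreeAlgebra ℂ (Fin 3)} (h : SpaceRel r u v) : mk r u = mk r v :=
  RingQuot.mkAlgHom_rel ℂ h

/-- The coordinate functions: `X r 0 = ξ`, `X r 1 = x`, `X r 2 = η`. -/
noncomputable def X (r : ℂˣ) (i : Fin 3) : SPSpace r := mk r (ι ℂ i)

/-- The homomorphism defined by the images of the generators. -/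
noncomputable def lift (f : Fin 3 → B)
    (h : ∀ u v, SpaceRel r u v → FreeAlgebra.lift ℂ f u = FreeAlgebra.lift ℂ f v) :
    SPSpace r →ₐ[ℂ] B :=
  RingQuot.liftAlgHom ℂ ⟨FreeAlgebra.lift ℂ f, fun {u v} => h u v⟩

theorem lift_X (f : Fin 3 → B)
    (h : ∀ u v, SpaceRel r u v → FreeAlgebra.lift ℂ f u = FreeAlgebra.lift ℂ f v) (i : Fin 3) :
    lift f h (X r i) = f i :=
  (RingQuot.liftAlgHom_mkAlgHom_apply ℂ _ _ _).trans (FreeAlgebra.lift_ι_apply f i)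

theorem hom_ext {f g : SPSpace r →ₐ[ℂ] B}
    (h : ∀ i, f (X r i) = g (X r i)) : f = g := by
  apply RingQuot.ringQuot_ext'
  ext i
  exact h i

theorem x_xi : X r 1 * X r 0 = q r • (X r 0 * X r 1) := by
  simpa [X] using mk_rel (SpaceRel.x_xi (r := r))

theorem x_eta : X r 1 * X r 2 = (q r)⁻¹ • (X r 2 * X r 1) := by
  simpa [X] using mk_rel (SpaceRel.x_eta (r := r))

theorem eta_xi : X r 2 * X r 0 =
    -(q r) ^ 2 • (X r 0 * X r 2) + ((r : ℂ) * (1 - q r)) • (X r 1 * X r 1) := by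
  simpa [X] using mk_rel (SpaceRel.eta_xi (r := r))

theorem xi_xi : X r 0 * X r 0 = 0 := by
  simpa [X] using mk_rel (SpaceRel.xi_xi (r := r))

theorem eta_eta : X r 2 * X r 2 = 0 := by
  simpa [X] using mk_rel (SpaceRel.eta_eta (r := r))

/-- The parity automorphism: `x` is even, `ξ` and `η` are odd. -/
noncomputable def parity (r : ℂˣ) : SPSpace r →ₐ[ℂ] SPSpace r :=
  lift ![-X r 0, X r 1, -X r 2] (by
    rintro _ _ ⟨⟩ <;> simp [x_xi, x_eta, eta_xi, xi_xi, eta_eta])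

theorem parity_parity (r : ℂˣ) (u : SPSpace r) : parity r (parity r u) = u := by
  have h : (parity r).comp (parity r) = AlgHom.id ℂ _ :=
    hom_ext fun i => by fin_cases i <;> simp [parity, lift_X]
  exact DFunLike.congr_fun h u

/-- The `ℤ₂`-grading of `𝒪(SP_q^{1|2})`. -/
noncomputable def grading (r : ℂˣ) : ZMod 2 → Submodule ℂ (SPSpace r) := parityPart (parity r)

noncomputable instance (r : ℂˣ) : GradedAlgebra (grading r) :=
  gradedOfInvolution (parity r) (parity_parity r)

theorem X_mem (r : ℂˣ) (i : Fin 3) : X r i ∈ grading r (idx i) := by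
  rw [grading, mem_parityPart]
  fin_cases i <;> simp [parity, lift_X, idx, ZMod.val_one]

end SPSpace

/-! ### The quantum supergroup -/

/-- The generators of `𝒪(SP_q(1|2))`. -/
inductive Gen
  | a | b | c | d | α | δ

section
local notation "𝐚" => ι ℂ Gen.a
local notation "𝐛" => ι ℂ Gen.b
local notation "𝐜" => ι ℂ Gen.c
local notation "𝐝" => ι ℂ Gen.d
local notation "𝛂" => ι ℂ Gen.α
local notation "𝛅" => ι ℂ Gen.δ

/-- The defining relations of `𝒪(SP_q(1|2))`; the last one says that the quantum superdeterminant
is `1`. -/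
inductive GroupRel (r : ℂˣ) : FreeAlgebra ℂ Gen → FreeAlgebra ℂ Gen → Prop
  | ab : GroupRel r (𝐚 * 𝐛) ((q r) ^ 2 • (𝐛 * 𝐚))
  | ac : GroupRel r (𝐚 * 𝐜) ((q r) ^ 2 • (𝐜 * 𝐚))
  | aα : GroupRel r (𝐚 * 𝛂) (q r • (𝛂 * 𝐚))
  | aδ : GroupRel r (𝐚 * 𝛅) (q r • (𝛅 * 𝐚) + (q r - (q r)⁻¹) • (𝛂 * 𝐜))
  | ad : GroupRel r (𝐚 * 𝐝)
      (𝐝 * 𝐚 + (q r - (q r)⁻¹) • ((1 + (q r)⁻¹) • (𝐛 * 𝐜) + (r : ℂ)⁻¹ • (𝛂 * 𝛅)))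
  | bc : GroupRel r (𝐛 * 𝐜) (𝐜 * 𝐛)
  | bd : GroupRel r (𝐛 * 𝐝) ((q r) ^ 2 • (𝐝 * 𝐛))
  | bα : GroupRel r (𝐛 * 𝛂) ((q r)⁻¹ • (𝛂 * 𝐛))
  | bδ : GroupRel r (𝐛 * 𝛅) (q r • (𝛅 * 𝐛))
  | cd : GroupRel r (𝐜 * 𝐝) ((q r) ^ 2 • (𝐝 * 𝐜))
  | cα : GroupRel r (𝐜 * 𝛂) ((q r)⁻¹ • (𝛂 * 𝐜))
  | cδ : GroupRel r (𝐜 * 𝛅) (q r • (𝛅 * 𝐜))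
  | dα : GroupRel r (𝐝 * 𝛂) ((q r)⁻¹ • (𝛂 * 𝐝) + ((q r)⁻¹ - q r) • (𝛅 * 𝐛))
  | dδ : GroupRel r (𝐝 * 𝛅) ((q r)⁻¹ • (𝛅 * 𝐝))
  | αδ : GroupRel r (𝛂 * 𝛅) (-q r • (𝛅 * 𝛂) + ((r : ℂ) * (q r - (q r)⁻¹)) • (𝐛 * 𝐜))
  | αα : GroupRel r (𝛂 * 𝛂) (((r : ℂ) * (q r - 1)) • (𝐛 * 𝐚))
  | δδ : GroupRel r (𝛅 * 𝛅) (((r : ℂ) * (q r - 1)) • (𝐝 * 𝐜))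
  | det : GroupRel r (𝐚 * 𝐝 - q r • (𝐛 * 𝐜) - (r : ℂ) • (𝛂 * 𝛅)) 1

end

/-- The algebra `𝒪(SP_q(1|2))`. -/
def SPGroup (r : ℂˣ) : Type := RingQuot (GroupRel r)

noncomputable instance (r : ℂˣ) : Ring (SPGroup r) := inferInstanceAs (Ring (RingQuot (GroupRel r)))
noncomputable instance (r : ℂˣ) : Algebra ℂ (SPGroup r) :=
  inferInstanceAs (Algebra ℂ (RingQuot (GroupRel r)))

namespace SPGroup

section
variable {r : ℂˣ} {B : Type} [Ring B] [Algebra ℂ B]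

/-- The quotient map from the free algebra. -/
noncomputable def mk (r : ℂˣ) : FreeAlgebra ℂ Gen →ₐ[ℂ] SPGroup r :=
  RingQuot.mkAlgHom ℂ (GroupRel r)

theorem mk_rel {u v : FreeAlgebra ℂ Gen} (h : GroupRel r u v) : mk r u = mk r v :=
  RingQuot.mkAlgHom_rel ℂ h

/-- The generators of `𝒪(SP_q(1|2))`. -/
noncomputable def gen (r : ℂˣ) (g : Gen) : SPGroup r := mk r (ι ℂ g)

/-- The homomorphism defined by the images of the generators. -/
noncomputable def lift (f : Gen → B)
    (h : ∀ u v, GroupRel r u v → FreeAlgebra.lift ℂ f u = FreeAlgebra.lift ℂ f v) :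
    SPGroup r →ₐ[ℂ] B :=
  RingQuot.liftAlgHom ℂ ⟨FreeAlgebra.lift ℂ f, fun {u v} => h u v⟩

theorem lift_gen (f : Gen → B)
    (h : ∀ u v, GroupRel r u v → FreeAlgebra.lift ℂ f u = FreeAlgebra.lift ℂ f v) (g : Gen) :
    lift f h (gen r g) = f g :=
  (RingQuot.liftAlgHom_mkAlgHom_apply ℂ _ _ _).trans (FreeAlgebra.lift_ι_apply f g)

theorem hom_ext {f g : SPGroup r →ₐ[ℂ] B} (h : ∀ i, f (gen r i) = g (gen r i)) : f = g := by
  apply RingQuot.ringQuot_ext'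
  ext i
  exact h i

/-- The quantum matrix `T = (t_ij)`. Its entries `γ`, `e`, `β` are determined by `a, b, c, d, α, δ`
through the quantum orthosymplectic condition `T T⁻¹ = T⁻¹ T = 1` (see `Tinv` and `T_mul_Tinv`). -/
noncomputable def T (r : ℂˣ) : Matrix (Fin 3) (Fin 3) (SPGroup r) :=
  let a := gen r .a
  let b := gen r .b
  let c := gen r .c
  let d := gen r .d
  let α := gen r .α
  let δ := gen r .δ
  let γ := (r : ℂ) • (δ * a) - (r : ℂ)⁻¹ • (c * α)
  let e := 1 - (r : ℂ)⁻¹ • (α * δ) + (q r - 1) • (b * c)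
  let β := (r : ℂ) • (b * δ) - (r : ℂ)⁻¹ • (α * d)
  !![a, α, b; γ, e, β; c, δ, d]

local notation "𝐚" => gen r Gen.a
local notation "𝐛" => gen r Gen.b
local notation "𝐜" => gen r Gen.c
local notation "𝐝" => gen r Gen.d
local notation "𝛂" => gen r Gen.α
local notation "𝛅" => gen r Gen.δ

theorem r_cb : 𝐜 * 𝐛 = 𝐛 * 𝐜 := by simpa [gen] using (mk_rel (GroupRel.bc (r := r))).symm
theorem r_αb : 𝛂 * 𝐛 = q r • (𝐛 * 𝛂) := by
  have := mk_rel (GroupRel.bα (r := r))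
  simp only [map_mul, map_smul] at this
  simp [gen, this, smul_smul, q_ne_zero]
theorem r_αc : 𝛂 * 𝐜 = q r • (𝐜 * 𝛂) := by
  have := mk_rel (GroupRel.cα (r := r))
  simp only [map_mul, map_smul] at this
  simp [gen, this, smul_smul, q_ne_zero]
theorem r_δb : 𝛅 * 𝐛 = (q r)⁻¹ • (𝐛 * 𝛅) := by
  have := mk_rel (GroupRel.bδ (r := r))
  simp only [map_mul, map_smul] at this
  simp [gen, this, smul_smul, q_ne_zero]
theorem r_δc : 𝛅 * 𝐜 = (q r)⁻¹ • (𝐜 * 𝛅) := by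
  have := mk_rel (GroupRel.cδ (r := r))
  simp only [map_mul, map_smul] at this
  simp [gen, this, smul_smul, q_ne_zero]
theorem r_ab : 𝐚 * 𝐛 = q r ^ 2 • (𝐛 * 𝐚) := by simpa [gen] using mk_rel (GroupRel.ab (r := r))
theorem r_ac : 𝐚 * 𝐜 = q r ^ 2 • (𝐜 * 𝐚) := by simpa [gen] using mk_rel (GroupRel.ac (r := r))
theorem r_db : 𝐝 * 𝐛 = (q r)⁻¹ ^ 2 • (𝐛 * 𝐝) := by
  have := mk_rel (GroupRel.bd (r := r))
  simp only [map_mul, map_smul] at this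
  simp [gen, this, smul_smul, q_ne_zero]
theorem r_dc : 𝐝 * 𝐜 = (q r)⁻¹ ^ 2 • (𝐜 * 𝐝) := by
  have := mk_rel (GroupRel.cd (r := r))
  simp only [map_mul, map_smul] at this
  simp [gen, this, smul_smul, q_ne_zero]
theorem r_αα : 𝛂 * 𝛂 = ((r : ℂ) * (q r - 1)) • (𝐛 * 𝐚) := by
  simpa [gen] using mk_rel (GroupRel.αα (r := r))
theorem r_αδ : 𝛂 * 𝛅 = -q r • (𝛅 * 𝛂) + ((r : ℂ) * (q r - (q r)⁻¹)) • (𝐛 * 𝐜) := by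
  simpa [gen] using mk_rel (GroupRel.αδ (r := r))
theorem r_δα : 𝛅 * 𝛂 = -(q r)⁻¹ • (𝛂 * 𝛅) + ((r : ℂ) * (1 - (q r)⁻¹ ^ 2)) • (𝐛 * 𝐜) := by
  rw [r_αδ]
  match_scalars <;> field_simp [q_ne_zero] <;> ring
theorem r_δδ : 𝛅 * 𝛅 = ((r : ℂ) * (q r - 1) * (q r)⁻¹ ^ 2) • (𝐜 * 𝐝) := by
  have : 𝛅 * 𝛅 = ((r : ℂ) * (q r - 1)) • (𝐝 * 𝐜) := by
    simpa [gen] using mk_rel (GroupRel.δδ (r := r))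
  rw [this, r_dc, smul_smul]
theorem r_aα : 𝐚 * 𝛂 = q r • (𝛂 * 𝐚) := by simpa [gen] using mk_rel (GroupRel.aα (r := r))
theorem r_aδ : 𝐚 * 𝛅 = q r • (𝛅 * 𝐚) + (q r ^ 2 - 1) • (𝐜 * 𝛂) := by
  have : 𝐚 * 𝛅 = q r • (𝛅 * 𝐚) + (q r - (q r)⁻¹) • (𝛂 * 𝐜) := by
    simpa [gen] using mk_rel (GroupRel.aδ (r := r))
  rw [this, r_αc]
  match_scalars <;> field_simp [q_ne_zero]
theorem r_dα : 𝐝 * 𝛂 = (q r)⁻¹ • (𝛂 * 𝐝) + ((q r)⁻¹ ^ 2 - 1) • (𝐛 * 𝛅) := by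
  have : 𝐝 * 𝛂 = (q r)⁻¹ • (𝛂 * 𝐝) + ((q r)⁻¹ - q r) • (𝛅 * 𝐛) := by
    simpa [gen] using mk_rel (GroupRel.dα (r := r))
  rw [this, r_δb]
  match_scalars <;> field_simp [q_ne_zero]
theorem r_dδ : 𝐝 * 𝛅 = (q r)⁻¹ • (𝛅 * 𝐝) := by simpa [gen] using mk_rel (GroupRel.dδ (r := r))
theorem r_det : 𝐚 * 𝐝 - q r • (𝐛 * 𝐜) - (r : ℂ) • (𝛂 * 𝛅) = 1 := by
  simpa [gen] using mk_rel (GroupRel.det (r := r))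
theorem r_ad : 𝐚 * 𝐝 = 1 + q r • (𝐛 * 𝐜) + (r : ℂ) • (𝛂 * 𝛅) := by
  rw [← r_det (r := r)]; abel
theorem r_ad' : 𝐚 * 𝐝 =
      𝐝 * 𝐚 + (q r - (q r)⁻¹) • ((1 + (q r)⁻¹) • (𝐛 * 𝐜) + (r : ℂ)⁻¹ • (𝛂 * 𝛅)) := by
  simpa [gen] using mk_rel (GroupRel.ad (r := r))
theorem r_da : 𝐝 * 𝐚 = 1 + ((q r)⁻¹ - 1 + (q r)⁻¹ ^ 2) • (𝐛 * 𝐜) + ((r : ℂ)⁻¹ ^ 3) • (𝛂 * 𝛅) := by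
  have h := r_ad' (r := r)
  rw [r_ad] at h
  rw [← sub_eq_iff_eq_add] at h
  rw [← h, q]
  match_scalars <;> field_simp <;> ring

theorem assoc_of {x y z : SPGroup r} (h : x * y = z) (w : SPGroup r) : x * (y * w) = z * w := by
  rw [← mul_assoc, h]


theorem nf :
    (𝐜 * 𝐛 = 𝐛 * 𝐜) ∧
    (𝛂 * 𝐛 = q r • (𝐛 * 𝛂)) ∧
    (𝛂 * 𝐜 = q r • (𝐜 * 𝛂)) ∧
    (𝛅 * 𝐛 = (q r)⁻¹ • (𝐛 * 𝛅)) ∧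
    (𝛅 * 𝐜 = (q r)⁻¹ • (𝐜 * 𝛅)) ∧
    (𝐚 * 𝐛 = q r ^ 2 • (𝐛 * 𝐚)) ∧
    (𝐚 * 𝐜 = q r ^ 2 • (𝐜 * 𝐚)) ∧
    (𝐝 * 𝐛 = (q r)⁻¹ ^ 2 • (𝐛 * 𝐝)) ∧
    (𝐝 * 𝐜 = (q r)⁻¹ ^ 2 • (𝐜 * 𝐝)) ∧
    (𝛂 * 𝛂 = ((r : ℂ) * (q r - 1)) • (𝐛 * 𝐚)) ∧
    (𝛅 * 𝛂 = -(q r)⁻¹ • (𝛂 * 𝛅) + ((r : ℂ) * (1 - (q r)⁻¹ ^ 2)) • (𝐛 * 𝐜)) ∧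
    (𝛅 * 𝛅 = ((r : ℂ) * (q r - 1) * (q r)⁻¹ ^ 2) • (𝐜 * 𝐝)) ∧
    (𝐚 * 𝛂 = q r • (𝛂 * 𝐚)) ∧
    (𝐚 * 𝛅 = q r • (𝛅 * 𝐚) + (q r ^ 2 - 1) • (𝐜 * 𝛂)) ∧
    (𝐝 * 𝛂 = (q r)⁻¹ • (𝛂 * 𝐝) + ((q r)⁻¹ ^ 2 - 1) • (𝐛 * 𝛅)) ∧
    (𝐝 * 𝛅 = (q r)⁻¹ • (𝛅 * 𝐝)) ∧
    (𝐚 * 𝐝 = 1 + q r • (𝐛 * 𝐜) + (r : ℂ) • (𝛂 * 𝛅)) ∧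
    (𝐝 * 𝐚 = 1 + ((q r)⁻¹ - 1 + (q r)⁻¹ ^ 2) • (𝐛 * 𝐜) + ((r : ℂ)⁻¹ ^ 3) • (𝛂 * 𝛅)) :=
  ⟨r_cb, r_αb, r_αc, r_δb, r_δc, r_ab, r_ac, r_db, r_dc, r_αα, r_δα, r_δδ, r_aα, r_aδ, r_dα, r_dδ, r_ad, r_da⟩

theorem nf' :
    (∀ w, 𝐜 * (𝐛 * w) = (𝐛 * 𝐜) * w) ∧
    (∀ w, 𝛂 * (𝐛 * w) = (q r • (𝐛 * 𝛂)) * w) ∧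
    (∀ w, 𝛂 * (𝐜 * w) = (q r • (𝐜 * 𝛂)) * w) ∧
    (∀ w, 𝛅 * (𝐛 * w) = ((q r)⁻¹ • (𝐛 * 𝛅)) * w) ∧
    (∀ w, 𝛅 * (𝐜 * w) = ((q r)⁻¹ • (𝐜 * 𝛅)) * w) ∧
    (∀ w, 𝐚 * (𝐛 * w) = (q r ^ 2 • (𝐛 * 𝐚)) * w) ∧
    (∀ w, 𝐚 * (𝐜 * w) = (q r ^ 2 • (𝐜 * 𝐚)) * w) ∧
    (∀ w, 𝐝 * (𝐛 * w) = ((q r)⁻¹ ^ 2 • (𝐛 * 𝐝)) * w) ∧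
    (∀ w, 𝐝 * (𝐜 * w) = ((q r)⁻¹ ^ 2 • (𝐜 * 𝐝)) * w) ∧
    (∀ w, 𝛂 * (𝛂 * w) = (((r : ℂ) * (q r - 1)) • (𝐛 * 𝐚)) * w) ∧
    (∀ w, 𝛅 * (𝛂 * w) = (-(q r)⁻¹ • (𝛂 * 𝛅) + ((r : ℂ) * (1 - (q r)⁻¹ ^ 2)) • (𝐛 * 𝐜)) * w) ∧
    (∀ w, 𝛅 * (𝛅 * w) = (((r : ℂ) * (q r - 1) * (q r)⁻¹ ^ 2) • (𝐜 * 𝐝)) * w) ∧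
    (∀ w, 𝐚 * (𝛂 * w) = (q r • (𝛂 * 𝐚)) * w) ∧
    (∀ w, 𝐚 * (𝛅 * w) = (q r • (𝛅 * 𝐚) + (q r ^ 2 - 1) • (𝐜 * 𝛂)) * w) ∧
    (∀ w, 𝐝 * (𝛂 * w) = ((q r)⁻¹ • (𝛂 * 𝐝) + ((q r)⁻¹ ^ 2 - 1) • (𝐛 * 𝛅)) * w) ∧
    (∀ w, 𝐝 * (𝛅 * w) = ((q r)⁻¹ • (𝛅 * 𝐝)) * w) ∧
    (∀ w, 𝐚 * (𝐝 * w) = (1 + q r • (𝐛 * 𝐜) + (r : ℂ) • (𝛂 * 𝛅)) * w) ∧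
    (∀ w, 𝐝 * (𝐚 * w) = (1 + ((q r)⁻¹ - 1 + (q r)⁻¹ ^ 2) • (𝐛 * 𝐜) + ((r : ℂ)⁻¹ ^ 3) • (𝛂 * 𝛅)) * w) :=
  ⟨assoc_of r_cb, assoc_of r_αb, assoc_of r_αc, assoc_of r_δb, assoc_of r_δc, assoc_of r_ab, assoc_of r_ac, assoc_of r_db, assoc_of r_dc, assoc_of r_αα, assoc_of r_δα, assoc_of r_δδ, assoc_of r_aα, assoc_of r_aδ, assoc_of r_dα, assoc_of r_dδ, assoc_of r_ad, assoc_of r_da⟩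

variable (r) in
/-- The parity automorphism: `a, b, c, d` are even, `α` and `δ` are odd. -/
noncomputable def parity : SPGroup r →ₐ[ℂ] SPGroup r :=
  lift (fun
      | .a => 𝐚
      | .b => 𝐛
      | .c => 𝐜
      | .d => 𝐝
      | .α => -𝛂
      | .δ => -𝛅) (by
    rintro _ _ ⟨⟩ <;>
    simp only [map_mul, map_smul, map_add, map_sub, map_one, FreeAlgebra.lift_ι_apply, neg_mul,
      mul_neg, smul_neg, neg_neg, smul_add, smul_smul, nf (r := r)] <;>
    simp only [q] <;> match_scalars <;> field_simp <;> ring)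

theorem parity_gen : parity r 𝐚 = 𝐚 ∧ parity r 𝐛 = 𝐛 ∧ parity r 𝐜 = 𝐜 ∧ parity r 𝐝 = 𝐝 ∧
    parity r 𝛂 = -𝛂 ∧ parity r 𝛅 = -𝛅 := by
  simp only [parity, lift_gen, and_self]

theorem parity_parity (r : ℂˣ) (u : SPGroup r) : parity r (parity r u) = u := by
  have h : (parity r).comp (parity r) = AlgHom.id ℂ _ :=
    hom_ext fun i => by cases i <;> simp [parity_gen]
  exact DFunLike.congr_fun h u

/-- The `ℤ₂`-grading of `𝒪(SP_q(1|2))`. -/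
noncomputable def grading (r : ℂˣ) : ZMod 2 → Submodule ℂ (SPGroup r) := parityPart (parity r)

noncomputable instance (r : ℂˣ) : GradedAlgebra (grading r) :=
  gradedOfInvolution (parity r) (parity_parity r)

theorem T_mem (r : ℂˣ) (i j : Fin 3) : T r i j ∈ grading r (idx i + idx j) := by
  rw [grading, mem_parityPart]
  fin_cases i <;> fin_cases j <;>
    simp [T, idx, parity_gen, ZMod.val_one, show (1 + 1 : ZMod 2) = 0 from rfl] <;> module

/-- The counit `ε(t_ij) = δ_ij`. -/
noncomputable def counit (r : ℂˣ) : SPGroup r →ₐ[ℂ] ℂ :=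
  lift (fun
      | .a => 1
      | .d => 1
      | _ => 0) (by
    rintro _ _ ⟨⟩ <;> simp)

theorem counit_T (r : ℂˣ) (i j : Fin 3) : counit r (T r i j) = if i = j then 1 else 0 := by
  fin_cases i <;> fin_cases j <;> simp [T, counit, lift_gen]

variable (r) in
/-- The element `∑ₖ t_ik ⊗ t_kj`. -/
noncomputable def comulT (i j : Fin 3) : grading r ᵍ⊗[ℂ] grading r := ∑ k, T r i k ᵍ⊗ₜ[ℂ] T r k j

theorem sgn_tmul (x y : SPGroup r) (i j k l : Fin 3) :
    (x ᵍ⊗ₜ[ℂ] T r i j : grading r ᵍ⊗[ℂ] grading r) * (T r k l ᵍ⊗ₜ[ℂ] y) =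
      ((-1 : ℂ) ^ ((idx i + idx j).val * (idx k + idx l).val)) •
        ((x * T r k l) ᵍ⊗ₜ[ℂ] (T r i j * y)) :=
  tmul_mul_tmul _ _ (T_mem r i j) (T_mem r k l) _ _

theorem T00 : T r 0 0 = 𝐚 := rfl
theorem T01 : T r 0 1 = 𝛂 := rfl
theorem T02 : T r 0 2 = 𝐛 := rfl
theorem T10 : T r 1 0 = (r : ℂ) • (𝛅 * 𝐚) - (r : ℂ)⁻¹ • (𝐜 * 𝛂) := rfl
theorem T11 : T r 1 1 = 1 - (r : ℂ)⁻¹ • (𝛂 * 𝛅) + (q r - 1) • (𝐛 * 𝐜) := rfl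
theorem T12 : T r 1 2 = (r : ℂ) • (𝐛 * 𝛅) - (r : ℂ)⁻¹ • (𝛂 * 𝐝) := rfl
theorem T20 : T r 2 0 = 𝐜 := rfl
theorem T21 : T r 2 1 = 𝛅 := rfl
theorem T22 : T r 2 2 = 𝐝 := rfl

set_option maxHeartbeats 4000000 in
theorem nfT :
    (𝐚 * T r 1 2 = ((r : ℂ) ^ 2 : ℂ) • (𝐛 * T r 1 0) + (-(r : ℂ) : ℂ) • (𝛂 * T r 1 1)) ∧
    (𝐝 * T r 1 0 = ((r : ℂ)⁻¹ ^ 2 : ℂ) • (𝐜 * T r 1 2) + ((r : ℂ)⁻¹ : ℂ) • (𝛅 * T r 1 1)) ∧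
    (T r 1 0 * 𝐛 = ((r : ℂ) ^ 2 : ℂ) • (𝐛 * T r 1 0)) ∧
    (T r 1 0 * 𝐜 = ((r : ℂ) ^ 2 : ℂ) • (𝐜 * T r 1 0)) ∧
    (T r 1 0 * 𝛂 = (-1 : ℂ) • (𝛂 * T r 1 0)) ∧
    (T r 1 0 * 𝛅 = (-(r : ℂ)⁻¹ ^ 2 + (r : ℂ) ^ 2 : ℂ) • (𝐜 * T r 1 1) + (-1 : ℂ) • (𝛅 * T r 1 0)) ∧
    (T r 1 0 * 𝐚 = ((r : ℂ)⁻¹ ^ 2 : ℂ) • (𝐚 * T r 1 0)) ∧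
    (T r 1 0 * 𝐝 = (-(r : ℂ)⁻¹ ^ 2 + 1 + (r : ℂ) ^ 2 : ℂ) • (𝐜 * T r 1 2) + ((r : ℂ) : ℂ) • (𝛅 * T r 1 1)) ∧
    (T r 1 2 * 𝐛 = ((r : ℂ)⁻¹ ^ 2 : ℂ) • (𝐛 * T r 1 2)) ∧
    (T r 1 2 * 𝐜 = ((r : ℂ)⁻¹ ^ 2 : ℂ) • (𝐜 * T r 1 2)) ∧
    (T r 1 2 * 𝛂 = ((r : ℂ)⁻¹ ^ 2 - (r : ℂ) ^ 2 : ℂ) • (𝐛 * T r 1 1) + (-1 : ℂ) • (𝛂 * T r 1 2)) ∧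
    (T r 1 2 * 𝛅 = (-1 : ℂ) • (𝛅 * T r 1 2)) ∧
    (T r 1 2 * 𝐚 = ((r : ℂ)⁻¹ ^ 2 + 1 - (r : ℂ) ^ 2 : ℂ) • (𝐛 * T r 1 0) + (-(r : ℂ)⁻¹ : ℂ) • (𝛂 * T r 1 1)) ∧
    (T r 1 2 * 𝐝 = ((r : ℂ) ^ 2 : ℂ) • (𝐝 * T r 1 2)) ∧
    (T r 1 1 * 𝐛 = 𝐛 * T r 1 1) ∧
    (T r 1 1 * 𝐜 = 𝐜 * T r 1 1) ∧
    (T r 1 1 * 𝛂 = (-(r : ℂ)⁻¹ + (r : ℂ) ^ 3 : ℂ) • (𝐛 * T r 1 0) + 𝛂 * T r 1 1) ∧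
    (T r 1 1 * 𝛅 = (-(r : ℂ)⁻¹ ^ 3 + (r : ℂ) : ℂ) • (𝐜 * T r 1 2) + 𝛅 * T r 1 1) ∧
    (T r 1 1 * 𝐚 = 𝐚 * T r 1 1 + (-(r : ℂ)⁻¹ ^ 2 + (r : ℂ) ^ 2 : ℂ) • (𝛂 * T r 1 0)) ∧
    (T r 1 1 * 𝐝 = ((r : ℂ)⁻¹ ^ 2 - (r : ℂ) ^ 2 : ℂ) • (𝛅 * T r 1 2) + 𝐝 * T r 1 1) ∧
    (T r 1 0 * T r 1 0 = (-(r : ℂ) + (r : ℂ) ^ 3 : ℂ) • (𝐜 * 𝐚)) ∧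
    (T r 1 0 * T r 1 2 = 𝛂 * 𝛅) ∧
    (T r 1 0 * T r 1 1 = (-(r : ℂ)⁻¹ - (r : ℂ) + (r : ℂ) ^ 3 : ℂ) • (𝐜 * 𝛂) + ((r : ℂ) : ℂ) • (𝛅 * 𝐚)) ∧
    (T r 1 2 * T r 1 0 = (-(r : ℂ)⁻¹ ^ 3 + (r : ℂ) : ℂ) • (𝐛 * 𝐜) + (-(r : ℂ)⁻¹ ^ 2 : ℂ) • (𝛂 * 𝛅)) ∧
    (T r 1 2 * T r 1 2 = (-(r : ℂ)⁻¹ ^ 3 + (r : ℂ)⁻¹ : ℂ) • (𝐛 * 𝐝)) ∧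
    (T r 1 2 * T r 1 1 = (-(r : ℂ)⁻¹ ^ 3 + (r : ℂ)⁻¹ + (r : ℂ) : ℂ) • (𝐛 * 𝛅) + (-(r : ℂ)⁻¹ : ℂ) • (𝛂 * 𝐝)) ∧
    (T r 1 1 * T r 1 0 = (-(r : ℂ) : ℂ) • (𝐜 * 𝛂) + ((r : ℂ) : ℂ) • (𝛅 * 𝐚)) ∧
    (T r 1 1 * T r 1 2 = ((r : ℂ)⁻¹ : ℂ) • (𝐛 * 𝛅) + (-(r : ℂ)⁻¹ : ℂ) • (𝛂 * 𝐝)) ∧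
    (T r 1 1 * T r 1 1 = 1 + (-(r : ℂ)⁻¹ ^ 2 + (r : ℂ) ^ 2 : ℂ) • (𝐛 * 𝐜) + (-2 * (r : ℂ)⁻¹ : ℂ) • (𝛂 * 𝛅)) := by
  refine ⟨?_, ?_, ?_, ?_, ?_, ?_, ?_, ?_, ?_, ?_, ?_, ?_, ?_, ?_, ?_, ?_, ?_, ?_, ?_, ?_, ?_, ?_, ?_, ?_, ?_, ?_, ?_, ?_, ?_⟩ <;>
  simp only [T10, T11, T12, mul_add, add_mul, sub_mul, mul_sub, smul_mul_assoc, mul_smul_comm,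
    mul_assoc, smul_add, smul_sub, smul_smul, one_mul, mul_one, nf (r := r), nf' (r := r)] <;>
  simp only [q] <;> match_scalars <;> field_simp <;> ring_nf
set_option maxHeartbeats 4000000 in
variable (r) in
/-- The comultiplication, `Δ(t_ij) = ∑ₖ t_ik ⊗ t_kj` (see `comul_T`). -/
noncomputable def comul : SPGroup r →ₐ[ℂ] grading r ᵍ⊗[ℂ] grading r :=
  lift (fun
      | .a => comulT r 0 0
      | .b => comulT r 0 2
      | .c => comulT r 2 0
      | .d => comulT r 2 2
      | .α => comulT r 0 1
      | .δ => comulT r 2 1) (by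
    rintro _ _ ⟨⟩ <;>
    simp only [map_mul, map_smul, map_add, map_sub, map_one, FreeAlgebra.lift_ι_apply, comulT,
        Fin.sum_univ_three, mul_add, mul_sub, sub_mul, smul_mul_assoc, add_mul, sgn_tmul] <;>
    simp only [idx, T00, T01, T02, T20, T21, T22, Matrix.cons_val, Matrix.cons_val_zero, Matrix.cons_val_one, add_zero, zero_add, show (1 + 1 : ZMod 2) = 0 from rfl, ZMod.val_zero, ZMod.val_one, zero_mul, mul_zero, mul_one, pow_zero, pow_one] <;>
    simp only [smul_add, smul_smul, nf (r := r), nfT (r := r), tmul_add', add_tmul', tmul_sub', sub_tmul', tmul_smul', smul_tmul', one_tmul_one] <;>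
    simp only [q] <;>
    match_scalars <;> field_simp <;> ring_nf)


set_option maxHeartbeats 4000000 in
theorem comul_T (i j : Fin 3) : comul r (T r i j) = ∑ k, T r i k ᵍ⊗ₜ[ℂ] T r k j := by
  have h0 : ∀ j, comul r (T r 0 j) = comulT r 0 j := by
    intro j; fin_cases j <;> simp [T, comul, lift_gen]
  have h2 : ∀ j, comul r (T r 2 j) = comulT r 2 j := by
    intro j; fin_cases j <;> simp [T, comul, lift_gen]
  have e : ∀ j, comul r (T r 1 j) = comulT r 1 j := by
    intro j
    fin_cases j <;> simp only [Fin.zero_eta, Fin.mk_one, Fin.reduceFinMk, T10, T11, T12, map_sub,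
      map_add, map_smul, map_mul, map_one, ← T00, ← T01, ← T02, ← T20, ← T21, ← T22, h0, h2] <;>
    simp only [comulT, Fin.sum_univ_three, mul_add, mul_sub, sub_mul, smul_mul_assoc, add_mul,
      sgn_tmul] <;>
    simp only [idx, T00, T01, T02, T20, T21, T22, Matrix.cons_val,
      Matrix.cons_val_zero, Matrix.cons_val_one, add_zero, zero_add,
      show (1 + 1 : ZMod 2) = 0 from rfl, ZMod.val_zero, ZMod.val_one, zero_mul, mul_zero, mul_one,
      pow_zero, pow_one] <;>
    simp only [smul_add, smul_smul, nf (r := r), nfT (r := r), tmul_add',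
      add_tmul', tmul_sub', sub_tmul', tmul_smul', smul_tmul'] <;>
    simp only [T10, T11, T12, mul_add, add_mul, sub_mul, mul_sub, smul_mul_assoc, mul_smul_comm, mul_assoc,
      smul_add, smul_sub, smul_smul, one_mul, mul_one, nf (r := r), nf' (r := r), tmul_add',
      add_tmul', tmul_sub', sub_tmul', tmul_smul', smul_tmul', one_tmul_one] <;>
    simp only [q] <;> match_scalars <;> field_simp <;> ring_nf
  fin_cases i
  · exact h0 j
  · exact e j
  · exact h2 j

variable (r) in
/-- The inverse of `T`. -/
noncomputable def Tinv : Matrix (Fin 3) (Fin 3) (SPGroup r) :=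
  !![𝐝, (r : ℂ)⁻¹ • T r 1 2, -(q r)⁻¹ • 𝐛;
    -(r : ℂ) • 𝛅, T r 1 1, (r : ℂ)⁻¹ • 𝛂;
    -q r • 𝐜, -(r : ℂ) • T r 1 0, 𝐚]

set_option maxHeartbeats 4000000 in
theorem T_mul_Tinv : T r * Tinv r = 1 ∧ Tinv r * T r = 1 := by
  constructor <;> ext i j <;> fin_cases i <;> fin_cases j <;>
    simp only [Matrix.mul_apply, Fin.sum_univ_three, Tinv, Fin.zero_eta, Fin.mk_one,
      Fin.reduceFinMk, T00, T01, T02, T20, T21, T22, Matrix.of_apply,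
      Matrix.cons_val, Matrix.one_apply_eq, ne_eq, Fin.reduceEq, not_false_eq_true,
      Matrix.one_apply_ne] <;>
    simp only [smul_mul_assoc, mul_smul_comm, smul_add, smul_smul, nf (r := r), nfT (r := r)] <;>
    (try simp only [T10, T11, T12, mul_add, mul_sub, mul_smul_comm, smul_add, smul_sub, smul_smul,
      mul_one, mul_assoc, nf (r := r), nf' (r := r), smul_mul_assoc]) <;>
    (try simp only [q]) <;> match_scalars <;> field_simp <;> ring_nf

end
end SPGroup

/-! ### The left coaction of the quantum supergroup on the quantum superspace -/

section
variable {r : ℂˣ}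

variable (r) in
/-- The element `∑ₖ t_ik ⊗ X_k`. -/
noncomputable def coactX (i : Fin 3) : SPGroup.grading r ᵍ⊗[ℂ] SPSpace.grading r :=
  ∑ k, SPGroup.T r i k ᵍ⊗ₜ[ℂ] SPSpace.X r k

theorem sgn_tmul_X (t : SPGroup r) (y : SPSpace r) (i k l : Fin 3) :
    (t ᵍ⊗ₜ[ℂ] SPSpace.X r i : SPGroup.grading r ᵍ⊗[ℂ] SPSpace.grading r) *
        (SPGroup.T r k l ᵍ⊗ₜ[ℂ] y) =
      ((-1 : ℂ) ^ ((idx i).val * (idx k + idx l).val)) •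
        ((t * SPGroup.T r k l) ᵍ⊗ₜ[ℂ] (SPSpace.X r i * y)) :=
  tmul_mul_tmul _ _ (SPSpace.X_mem r i) (SPGroup.T_mem r k l) _ _

open SPGroup SPSpace in
set_option maxHeartbeats 4000000 in
variable (r) in
/-- The left coaction `δ_L : 𝒪(SP_q^{1|2}) → 𝒪(SP_q(1|2)) ⊗ 𝒪(SP_q^{1|2})`, the algebra homomorphism
with `δ_L(X_i) = ∑ₖ t_ik ⊗ X_k`. -/
noncomputable def coact : SPSpace r →ₐ[ℂ] SPGroup.grading r ᵍ⊗[ℂ] SPSpace.grading r :=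
  SPSpace.lift (coactX r) (by
    rintro _ _ ⟨⟩ <;>
    simp only [map_mul, map_smul, map_add, map_zero, FreeAlgebra.lift_ι_apply, coactX,
      Fin.sum_univ_three, mul_add, add_mul, sgn_tmul_X] <;>
    simp only [idx, T00, T01, T02, T20, T21, T22, Matrix.cons_val, Matrix.cons_val_zero,
      Matrix.cons_val_one, add_zero, zero_add, show (1 + 1 : ZMod 2) = 0 from rfl, ZMod.val_zero,
      ZMod.val_one, zero_mul, mul_zero, mul_one, pow_zero, pow_one] <;>
    simp only [smul_add, smul_smul, nf (r := r), nfT (r := r), x_xi, x_eta, eta_xi, xi_xi, eta_eta,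
      tmul_add', add_tmul', tmul_smul', smul_tmul', tmul_zero'] <;>
    simp only [q] <;>
    match_scalars <;> field_simp <;> ring_nf)

theorem coact_X (i : Fin 3) : coact r (SPSpace.X r i) = ∑ k, SPGroup.T r i k ᵍ⊗ₜ[ℂ] SPSpace.X r k :=
  SPSpace.lift_X _ _ i

end

/-! ### First order differential calculi and their covariance -/

section Calculus

/-- The projection of a `ℤ₂`-graded space to its homogeneous part of degree `i`. -/
noncomputable def proj {M : Type} [AddCommGroup M] [Module ℂ M] (ℳ : ZMod 2 → Submodule ℂ M)
    [DirectSum.Decomposition ℳ] (i : ZMod 2) : M →ₗ[ℂ] M :=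
  (ℳ i).subtype ∘ₗ DirectSum.component ℂ (ZMod 2) (fun j => ℳ j) i ∘ₗ
    (DirectSum.decomposeLinearEquiv ℳ).toLinearMap

theorem proj_of_mem {M : Type} [AddCommGroup M] [Module ℂ M] (ℳ : ZMod 2 → Submodule ℂ M)
    [DirectSum.Decomposition ℳ] {i : ZMod 2} {m : M} (hm : m ∈ ℳ i) (j : ZMod 2) :
    proj ℳ j m = if i = j then m else 0 := by
  rw [show proj ℳ j m = (DirectSum.decompose ℳ m j : M) from rfl]
  split_ifs with h
  · subst h
    exact DirectSum.decompose_of_mem_same ℳ hm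
  · exact DirectSum.decompose_of_mem_ne ℳ hm h

variable {A X Γ : Type} [Ring A] [Algebra ℂ A] [Ring X] [Algebra ℂ X] [AddCommGroup Γ] [Module ℂ Γ]
  [Module X Γ] [Module Xᵐᵒᵖ Γ] [IsScalarTower ℂ X Γ] [IsScalarTower ℂ Xᵐᵒᵖ Γ]
  (𝒜 : ZMod 2 → Submodule ℂ A) [DirectSum.Decomposition 𝒜]
  (𝒳 : ZMod 2 → Submodule ℂ X) [DirectSum.Decomposition 𝒳]
  (𝒢 : ZMod 2 → Submodule ℂ Γ) [DirectSum.Decomposition 𝒢]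

/-- The map `τ(a) = (-1)^{p(a)} a`. -/
noncomputable def signMap : A →ₗ[ℂ] A := ∑ i, (-1 : ℂ) ^ i.val • proj 𝒜 i

/-- The left action of the superalgebra `A ⊗ X` on `A ⊗ Γ`, with
`(a ⊗ u)(b ⊗ w) = (-1)^{p(u)p(b)} ab ⊗ uw` on homogeneous elements. -/
noncomputable def leftAct : A ⊗[ℂ] X →ₗ[ℂ] A ⊗[ℂ] Γ →ₗ[ℂ] A ⊗[ℂ] Γ :=
  ∑ i, ∑ j, (-1 : ℂ) ^ (i.val * j.val) •
    TensorProduct.map₂ ((LinearMap.mul ℂ A).compl₂ (proj 𝒜 j))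
        ((Algebra.lsmul ℂ ℂ Γ).toLinearMap ∘ₗ proj 𝒳 i)

/-- The right action of the superalgebra `A ⊗ X` on `A ⊗ Γ`, written as a function of the element of
`A ⊗ X` first, with `(a ⊗ w)(b ⊗ u) = (-1)^{p(w)p(b)} ab ⊗ wu` on homogeneous elements. -/
noncomputable def rightAct : A ⊗[ℂ] X →ₗ[ℂ] A ⊗[ℂ] Γ →ₗ[ℂ] A ⊗[ℂ] Γ :=
  ∑ i, ∑ j, (-1 : ℂ) ^ (i.val * j.val) •
    TensorProduct.map₂ ((LinearMap.mul ℂ A).flip ∘ₗ proj 𝒜 j)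
        (((Algebra.lsmul ℂ ℂ Γ).toLinearMap ∘ₗ
          (MulOpposite.opLinearEquiv ℂ : X ≃ₗ[ℂ] Xᵐᵒᵖ).toLinearMap).compl₂ (proj 𝒢 i))

theorem signMap_of_mem {i : ZMod 2} {a : A} (ha : a ∈ 𝒜 i) :
    signMap 𝒜 a = (-1 : ℂ) ^ i.val • a := by
  simp [signMap, proj_of_mem 𝒜 ha]

theorem leftAct_tmul {i j : ZMod 2} {u : X} {b : A} (hu : u ∈ 𝒳 i) (hb : b ∈ 𝒜 j) (a : A) (w : Γ) :
    leftAct 𝒜 𝒳 (a ⊗ₜ[ℂ] u) (b ⊗ₜ[ℂ] w) =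
      (-1 : ℂ) ^ (i.val * j.val) • ((a * b) ⊗ₜ[ℂ] (u • w)) := by
  simp only [leftAct, LinearMap.sum_apply, LinearMap.smul_apply, LinearMap.comp_apply,
    TensorProduct.map₂_apply_tmul, proj_of_mem 𝒳 hu]
  rw [Finset.sum_eq_single i, Finset.sum_eq_single j] <;>
    simp +contextual [proj_of_mem 𝒜 hb, eq_comm]

theorem rightAct_tmul {i j : ZMod 2} {w : Γ} {b : A} (hw : w ∈ 𝒢 i) (hb : b ∈ 𝒜 j) (a : A) (u : X) :
    rightAct 𝒜 𝒢 (b ⊗ₜ[ℂ] u) (a ⊗ₜ[ℂ] w) =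
      (-1 : ℂ) ^ (i.val * j.val) • ((a * b) ⊗ₜ[ℂ] (w <• u)) := by
  simp only [rightAct, LinearMap.sum_apply, LinearMap.smul_apply, LinearMap.comp_apply,
    TensorProduct.map₂_apply_tmul, proj_of_mem 𝒜 hb]
  rw [Finset.sum_eq_single i, Finset.sum_eq_single j] <;>
    simp +contextual [proj_of_mem 𝒢 hw, eq_comm]

/-- `ρ : M → A ⊗ M` is a left coaction of `A`, with comultiplication `Δ` and counit `ε`, on `M`:
`(id ⊗ ρ) ∘ ρ = (Δ ⊗ id) ∘ ρ` and `(ε ⊗ id) ∘ ρ = id`. -/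
structure IsLeftCoaction {M : Type} [AddCommGroup M] [Module ℂ M] (Δ : A →ₗ[ℂ] A ⊗[ℂ] A)
    (ε : A →ₗ[ℂ] ℂ) (ρ : M →ₗ[ℂ] A ⊗[ℂ] M) : Prop where
  coassoc : ρ.lTensor A ∘ₗ ρ = (TensorProduct.assoc ℂ A A M).toLinearMap ∘ₗ Δ.rTensor M ∘ₗ ρ
  counit : (TensorProduct.lid ℂ M).toLinearMap ∘ₗ ε.rTensor M ∘ₗ ρ = LinearMap.id

end Calculus

/-- A first order `ℤ₂`-graded differential calculus over the superalgebra `X`: a `ℤ₂`-graded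
`X`-bimodule with a linear map `d` of grade one that satisfies the graded Leibniz rule, and that is
the linear span of the elements `a · d b · c`. -/
structure Calculus {X : Type} [Ring X] [Algebra ℂ X] (𝒳 : ZMod 2 → Submodule ℂ X)
    [GradedAlgebra 𝒳] where
  /-- The bimodule. -/
  carrier : Type
  [addCommGroup : AddCommGroup carrier]
  [module : Module ℂ carrier]
  [leftModule : Module X carrier]
  [rightModule : Module Xᵐᵒᵖ carrier]
  [smulCommClass : SMulCommClass X Xᵐᵒᵖ carrier]
  [leftTower : IsScalarTower ℂ X carrier]
  [rightTower : IsScalarTower ℂ Xᵐᵒᵖ carrier]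
  /-- The grading of the bimodule. -/
  grading : ZMod 2 → Submodule ℂ carrier
  [decomposition : DirectSum.Decomposition grading]
  smul_mem : ∀ {i j : ZMod 2} {u : X} {w : carrier},
    u ∈ 𝒳 i → w ∈ grading j → u • w ∈ grading (i + j)
  op_smul_mem : ∀ {i j : ZMod 2} {w : carrier} {u : X},
    w ∈ grading i → u ∈ 𝒳 j → w <• u ∈ grading (i + j)
  /-- The differential. -/
  d : X →ₗ[ℂ] carrier
  d_mem : ∀ {i : ZMod 2} {u : X}, u ∈ 𝒳 i → d u ∈ grading (i + 1)
  leibniz : ∀ {i : ZMod 2} {f : X}, f ∈ 𝒳 i → ∀ g : X,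
    d (f * g) = d f <• g + (-1 : ℂ) ^ i.val • (f • d g)
  span_eq_top : Submodule.span ℂ {w | ∃ a b c : X, w = a • (d b <• c)} = ⊤

attribute [instance] Calculus.addCommGroup Calculus.module Calculus.leftModule Calculus.rightModule
  Calculus.smulCommClass Calculus.leftTower Calculus.rightTower Calculus.decomposition

section Covariance
variable {A X : Type} [Ring A] [Algebra ℂ A] [Ring X] [Algebra ℂ X]
  {𝒜 : ZMod 2 → Submodule ℂ A} [GradedAlgebra 𝒜] {𝒳 : ZMod 2 → Submodule ℂ X} [GradedAlgebra 𝒳]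

/-- Let `X` be a left quantum space of `A` (with comultiplication `Δ` and counit `ε`) by the algebra
homomorphism `δ`. The calculus `Γ` over `X` is left-covariant if there is a left coaction `ΔL` of `A`
on `Γ` that is multiplicative over `δ`, that is `ΔL(u w) = δ(u) ΔL(w)` and `ΔL(w u) = ΔL(w) δ(u)`,
and that satisfies `ΔL ∘ d = (τ ⊗ d) ∘ δ`. -/
def Calculus.IsLeftCovariant (Γ : Calculus 𝒳) (Δ : A →ₐ[ℂ] 𝒜 ᵍ⊗[ℂ] 𝒜) (ε : A →ₐ[ℂ] ℂ)
    (δ : X →ₐ[ℂ] 𝒜 ᵍ⊗[ℂ] 𝒳) : Prop :=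
  let Δ' : A →ₗ[ℂ] A ⊗[ℂ] A := (GradedTensorProduct.of ℂ 𝒜 𝒜).symm.toLinearMap ∘ₗ Δ.toLinearMap
  let δ' : X →ₗ[ℂ] A ⊗[ℂ] X := (GradedTensorProduct.of ℂ 𝒜 𝒳).symm.toLinearMap ∘ₗ δ.toLinearMap
  IsLeftCoaction Δ' ε.toLinearMap δ' ∧
    ∃ ΔL : Γ.carrier →ₗ[ℂ] A ⊗[ℂ] Γ.carrier,
      IsLeftCoaction Δ' ε.toLinearMap ΔL ∧
      (∀ u w, ΔL (u • w) = leftAct 𝒜 𝒳 (δ' u) (ΔL w)) ∧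
      (∀ w u, ΔL (w <• u) = rightAct 𝒜 Γ.grading (δ' u) (ΔL w)) ∧
      ∀ u, ΔL (Γ.d u) = TensorProduct.map (signMap 𝒜) Γ.d (δ' u)

end Covariance

end QSP

/-! The calculus is realised on the column vectors `𝒳³`, with `dξ, dx, dη` as standard basis. Right
multiplication is coordinatewise, so freeness holds by construction and no basis of `𝒳` itself is
needed. The stated relations prescribe how each coordinate moves past the three basis forms. They
give a `3 × 3` matrix over `𝒳` for each coordinate, and a left action commuting with the right one
amounts to an algebra homomorphism `L : 𝒳 → M₃(𝒳)` (`leftHom`). Since `𝒳` is given by generators and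
relations, it suffices that the three matrices satisfy the five defining relations.

The differential comes from the same principle. A map `d` obeys the graded Leibniz rule exactly when
`f ↦ (L(τ f), d f; 0, f)` is multiplicative, because the upper right block of a product is `L(τ f) d
g + (d f) g`. Thus `d` exists and is unique with `d X_i` the `i`-th basis vector, once the block
matrices satisfy the five relations (`leibnizHom`).

Covariance is proved for every calculus in which the `dX_i` form a right basis and satisfy the
stated relations. The Leibniz rule forces `Δ_L(dX_j) = (τ ⊗ d)(δ_L X_j)`, and freeness lets this
extend to all forms by right multiplicativity (`coactForms`). Left multiplicativity reduces, since
the left and right actions of `𝒜 ⊗ 𝒳` on `𝒜 ⊗ Γ` commute, to the nine products `X_i · dX_j`. These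
are the computational core (`lact_coactX_dA`) and follow from the quadratic relations among the
`t_ij`. Compatibility with `d` follows because `τ ⊗ d` is a graded derivation (`Calculus.dA_mul`).
Coassociativity and counitality need checking only on right module generators
(`isLeftCoaction_of_generators`), where they express `Δ(t_ij) = ∑ t_ik ⊗ t_kj` and `ε(t_ij) = δ_ij`;
the same criterion serves for `𝒳` and for `Γ`. -/

namespace QSP

/-! ### The left multiplication matrices of the quantum superspace -/

namespace SPSpace
variable {r : ℂˣ}

/-- Every element is the image of a noncommutative polynomial, so multiplicative statements below
reduce to the three coordinates. -/
theorem induction {P : SPSpace r → Prop} (scalar : ∀ c : ℂ, P (algebraMap ℂ _ c))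
    (gen : ∀ i, P (X r i)) (add : ∀ u v, P u → P v → P (u + v))
    (mul : ∀ u v, P u → P v → P (u * v)) (u : SPSpace r) : P u := by
  obtain ⟨a, rfl⟩ := RingQuot.mkAlgHom_surjective ℂ (SpaceRel r) u
  change P (mk r a)
  induction a with
  | grade0 c => simpa using scalar c
  | grade1 i => exact gen i
  | mul a b ha hb => rw [map_mul]; exact mul _ _ ha hb
  | add a b ha hb => rw [map_add]; exact add _ _ ha hb

theorem parity_X (i : Fin 3) : parity r (X r i) = (-1 : ℂ) ^ (idx i).val • X r i := by
  fin_cases i <;> simp [parity, lift_X, idx, ZMod.val_one]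

variable (r) in
/-- The matrices of left multiplication by the coordinates on the one-forms, in the right basis
`dξ, dx, dη`. -/
noncomputable def leftMatrix : Fin 3 → Matrix (Fin 3) (Fin 3) (SPSpace r) :=
  ![!![X r 0, 0, 0;
       0, -q r • X r 0, 0;
       0, 0, q r ^ 2 • X r 0],
    !![q r • X r 1, 0, 0;
       (q r ^ 2 - 1) • X r 0, q r • X r 1, 0;
       0, ((r : ℂ) * (q r ^ 2 - 1)) • X r 0, q r • X r 1],
    !![q r ^ 2 • X r 2, 0, 0;
       ((q r ^ 2 - 1) * (r : ℂ)) • X r 1, -q r • X r 2, 0;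
       ((1 - q r ^ 2) * (1 + q r)) • X r 0, (1 - q r ^ 2) • X r 1, X r 2]]

set_option maxHeartbeats 1000000 in
variable (r) in
/-- The left action of the quantum superspace on the one-forms, as matrices acting on column
vectors. -/
noncomputable def leftHom : SPSpace r →ₐ[ℂ] Matrix (Fin 3) (Fin 3) (SPSpace r) :=
  lift (leftMatrix r) (by
    -- Each defining relation becomes nine identities in `𝒳`, settled by the quadratic relations of
    -- `𝒳` itself.
    rintro _ _ ⟨⟩ <;> ext i j <;> fin_cases i <;> fin_cases j <;>
    simp [leftMatrix, Matrix.mul_apply, Fin.sum_univ_three, x_xi, x_eta, eta_xi, xi_xi, eta_eta,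
      smul_smul, -neg_smul] <;>
    (try simp only [q]) <;> (try match_scalars) <;> (try field_simp) <;> ring_nf)

theorem leftHom_X (i : Fin 3) : leftHom r (X r i) = leftMatrix r i := lift_X _ _ i

end SPSpace

/-! ### Gradings of vector spaces by eigenspaces of an involution -/

section Involution
variable {V : Type} [AddCommGroup V] [Module ℂ V]

/-- The eigenspace of an involution for the eigenvalue `(-1) ^ i`. -/
def eigenPart (σ : V →ₗ[ℂ] V) (i : ZMod 2) : Submodule ℂ V :=
  LinearMap.ker (σ - (-1 : ℂ) ^ i.val • LinearMap.id)

theorem mem_eigenPart {σ : V →ₗ[ℂ] V} {i : ZMod 2} {v : V} :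
    v ∈ eigenPart σ i ↔ σ v = (-1 : ℂ) ^ i.val • v := by
  simp [eigenPart, sub_eq_zero]

theorem half_add_mem {σ : V →ₗ[ℂ] V} (h : ∀ v, σ (σ v) = v) (v : V) :
    ((1 / 2 : ℂ) • (LinearMap.id + σ) : V →ₗ[ℂ] V) v ∈ eigenPart σ 0 := by
  simp [mem_eigenPart, h, add_comm]

theorem half_sub_mem {σ : V →ₗ[ℂ] V} (h : ∀ v, σ (σ v) = v) (v : V) :
    ((1 / 2 : ℂ) • (LinearMap.id - σ) : V →ₗ[ℂ] V) v ∈ eigenPart σ 1 := by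
  rw [mem_eigenPart]
  simp [ZMod.val_one, h, ← smul_neg]

/-- The `ℤ₂`-grading of a vector space defined by an involution. -/
@[reducible] noncomputable def decompositionOfInvolution (σ : V →ₗ[ℂ] V) (h : ∀ v, σ (σ v) = v) :
    DirectSum.Decomposition (eigenPart σ) :=
  DirectSum.Decomposition.ofLinearMap _
    (DirectSum.lof ℂ _ (fun i => eigenPart σ i) 0 ∘ₗ
        LinearMap.codRestrict _ ((1 / 2 : ℂ) • (LinearMap.id + σ)) (half_add_mem h) +
      DirectSum.lof ℂ _ (fun i => eigenPart σ i) 1 ∘ₗ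
        LinearMap.codRestrict _ ((1 / 2 : ℂ) • (LinearMap.id - σ)) (half_sub_mem h))
    (by
      ext v
      simp [DirectSum.coeLinearMap_lof]
      module)
    (by
      ext i v : 2
      obtain ⟨v, hv⟩ := v
      have hv' := mem_eigenPart.1 hv
      rcases zmod_two_cases i with rfl | rfl
      · have h0 : LinearMap.codRestrict (eigenPart σ 0) ((1 / 2 : ℂ) • (LinearMap.id + σ))
          (half_add_mem h) v = ⟨v, hv⟩ := by
          ext; simp at hv'; simp [hv']; module
        have h1 : LinearMap.codRestrict (eigenPart σ 1) ((1 / 2 : ℂ) • (LinearMap.id - σ))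
          (half_sub_mem h) v = 0 := by
          ext; simp at hv'; simp [hv']
        simp only [LinearMap.comp_apply, LinearMap.add_apply, DirectSum.coeLinearMap_lof, h0, h1,
          map_zero, add_zero, LinearMap.id_apply]
      · have h0 : LinearMap.codRestrict (eigenPart σ 0) ((1 / 2 : ℂ) • (LinearMap.id + σ))
          (half_add_mem h) v = 0 := by
          ext; simp [ZMod.val_one] at hv'; simp [hv']
        have h1 : LinearMap.codRestrict (eigenPart σ 1) ((1 / 2 : ℂ) • (LinearMap.id - σ))
          (half_sub_mem h) v = ⟨v, hv⟩ := by
          ext; simp [ZMod.val_one] at hv'; simp [hv']; module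
        simp only [LinearMap.comp_apply, LinearMap.add_apply, DirectSum.coeLinearMap_lof, h0, h1,
          map_zero, zero_add, LinearMap.id_apply])

end Involution

/-! ### Construction of the calculus -/

namespace SPSpace
variable {r : ℂˣ}

variable (r) in
/-- The images of the coordinates under `f ↦ (τ(f), d f; 0, f)`. -/
noncomputable def leibnizMatrix (i : Fin 3) : Matrix (Fin 3 ⊕ Unit) (Fin 3 ⊕ Unit) (SPSpace r) :=
  Matrix.fromBlocks (leftHom r (parity r (X r i))) (Matrix.of fun k _ => if k = i then 1 else 0) 0
    (Matrix.of fun _ _ => X r i)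

set_option maxHeartbeats 1000000 in
variable (r) in
/-- The homomorphism `f ↦ (τ(f), d f; 0, f)`. -/
noncomputable def leibnizHom :
    SPSpace r →ₐ[ℂ] Matrix (Fin 3 ⊕ Unit) (Fin 3 ⊕ Unit) (SPSpace r) :=
  lift (leibnizMatrix r) (by
    rintro _ _ ⟨⟩ <;>
    simp only [map_mul, map_smul, map_add, FreeAlgebra.lift_ι_apply, leibnizMatrix,
      Matrix.fromBlocks_multiply, Matrix.fromBlocks_add, Matrix.fromBlocks_smul, map_zero,
      ← Matrix.fromBlocks_zero, Matrix.fromBlocks_inj, Matrix.mul_zero, Matrix.zero_mul,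
      add_zero, smul_zero, zero_add, true_and] <;>
    -- The diagonal blocks merely repeat the relation under `L ∘ τ` and under the identity. The
    -- upper right block is the real condition: applying the Leibniz rule to both sides of the
    -- relation must give the same form.
    refine ⟨?_, ?_, ?_⟩ <;>
    first
    | simp only [← map_mul, ← map_smul, ← map_add, x_xi, x_eta, eta_xi, xi_xi, eta_eta, map_zero]
    | ext i j
      simp only [Matrix.add_apply, Matrix.smul_apply, Matrix.mul_apply, Matrix.zero_apply,
        Fin.sum_univ_three, Matrix.of_apply, Finset.univ_unique, Finset.sum_singleton]
      fin_cases i <;>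
      simp [parity_X, leftHom_X, leftMatrix, idx,
        ZMod.val_one, x_xi, x_eta, eta_xi, xi_xi, eta_eta] <;>
      (try simp only [q]) <;> (try match_scalars) <;> (try field_simp) <;> ring_nf)

/-- The three blocks are treated together because the upper left block of a product is
multiplicative only when the lower left blocks vanish. -/
theorem leibnizHom_apply (u : SPSpace r) :
    (∀ k l, leibnizHom r u (.inl k) (.inl l) = leftHom r (parity r u) k l) ∧
      (∀ l, leibnizHom r u (.inr ()) (.inl l) = 0) ∧ leibnizHom r u (.inr ()) (.inr ()) = u := by
  induction u using SPSpace.induction with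
  | scalar c => simp [Matrix.algebraMap_matrix_apply]
  | gen i => simp [leibnizHom, lift_X, leibnizMatrix]
  | add u v hu hv => simp [hu, hv]
  | mul u v hu hv => simp [hu, hv, Matrix.mul_apply]

/-- The one-forms on the quantum superspace: the free right module on `dξ, dx, dη`. -/
def Forms (r : ℂˣ) : Type := Fin 3 → SPSpace r

namespace Forms

noncomputable instance : AddCommGroup (Forms r) := inferInstanceAs (AddCommGroup (Fin 3 → SPSpace r))
noncomputable instance : Module ℂ (Forms r) := inferInstanceAs (Module ℂ (Fin 3 → SPSpace r))
noncomputable instance : Module (SPSpace r)ᵐᵒᵖ (Forms r) :=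
  inferInstanceAs (Module (SPSpace r)ᵐᵒᵖ (Fin 3 → SPSpace r))

@[ext] theorem ext {v w : Forms r} (h : ∀ k, v k = w k) : v = w := funext h
@[simp] theorem add_apply (v w : Forms r) (k : Fin 3) : (v + w) k = v k + w k := rfl
@[simp] theorem zero_apply (k : Fin 3) : (0 : Forms r) k = 0 := rfl
@[simp] theorem smul_apply (c : ℂ) (v : Forms r) (k : Fin 3) : (c • v) k = c • v k := rfl
@[simp] theorem op_smul_apply (v : Forms r) (u : SPSpace r) (k : Fin 3) :
    (v <• u) k = v k * u := rfl

/-- The form with the given coordinates. -/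
def mk (v : Fin 3 → SPSpace r) : Forms r := v

@[simp] theorem mk_apply (v : Fin 3 → SPSpace r) (k : Fin 3) : mk v k = v k := rfl

/-- The left action goes through the matrices of `leftHom`. Keeping `Forms` as a separate type
prevents confusion with coordinatewise left multiplication on functions. -/
noncomputable instance : SMul (SPSpace r) (Forms r) where
  smul u v := mk fun k => ∑ l, leftHom r u k l * v l

theorem left_smul_apply (u : SPSpace r) (v : Forms r) (k : Fin 3) :
    (u • v) k = ∑ l, leftHom r u k l * v l := rfl

noncomputable instance : Module (SPSpace r) (Forms r) where
  one_smul v := by ext k; fin_cases k <;> simp [left_smul_apply, Matrix.one_apply, Fin.sum_univ_three]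
  mul_smul u w v := by
    ext k
    simp only [left_smul_apply, map_mul, Matrix.mul_apply, Finset.sum_mul, Finset.mul_sum, mul_assoc]
    exact Finset.sum_comm
  smul_zero u := by ext k; simp [left_smul_apply]
  smul_add u v w := by ext k; simp [left_smul_apply, mul_add, Finset.sum_add_distrib]
  add_smul u w v := by ext k; simp [left_smul_apply, add_mul, Finset.sum_add_distrib]
  zero_smul v := by ext k; simp [left_smul_apply]

instance : SMulCommClass (SPSpace r) (SPSpace r)ᵐᵒᵖ (Forms r) where
  smul_comm u s v := by
    obtain ⟨s, rfl⟩ := MulOpposite.op_surjective s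
    ext k
    simp [left_smul_apply, Finset.sum_mul, mul_assoc]

instance : IsScalarTower ℂ (SPSpace r) (Forms r) where
  smul_assoc c u v := by
    ext k
    simp [left_smul_apply, Finset.smul_sum]

instance : IsScalarTower ℂ (SPSpace r)ᵐᵒᵖ (Forms r) where
  smul_assoc c u v := by
    ext k
    change v k * (c • u.unop) = c • (v k * u.unop)
    simp

/-- The form `dX_j`. -/
noncomputable def e (r : ℂˣ) (j : Fin 3) : Forms r := mk fun k => if k = j then 1 else 0

theorem e_apply (j k : Fin 3) : e r j k = if k = j then 1 else 0 := rfl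

theorem eq_sum (v : Forms r) : v = ∑ j, e r j <• v j := by
  ext k
  fin_cases k <;> simp [Fin.sum_univ_three, e_apply]

/-- The forms `dξ, dx, dη` as a basis of the right module. -/
noncomputable def basis (r : ℂˣ) : Module.Basis (Fin 3) (SPSpace r)ᵐᵒᵖ (Forms r) :=
  .ofEquivFun
    { toFun := fun v k => MulOpposite.op (v k)
      invFun := fun v => mk fun k => (v k).unop
      map_add' := fun _ _ => rfl
      map_smul' := fun _ _ => rfl
      left_inv := fun _ => rfl
      right_inv := fun _ => rfl }

theorem basis_apply (j : Fin 3) : basis r j = e r j := by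
  ext k
  simp only [basis, Module.Basis.coe_ofEquivFun]
  change MulOpposite.unop ((Pi.single j 1 : Fin 3 → (SPSpace r)ᵐᵒᵖ) k) = _
  by_cases h : k = j
  · subst h; simp [e_apply]
  · simp [e_apply, h]

/-- The parity automorphism of the one-forms. -/
noncomputable def parity (r : ℂˣ) : Forms r →ₗ[ℂ] Forms r where
  -- The basis form `dX_k` has parity `idx k + 1`, which adds to the parity of its coefficient.
  toFun v := mk fun k => (-1 : ℂ) ^ (idx k + 1).val • SPSpace.parity r (v k)
  map_add' v w := by ext k; simp
  map_smul' c v := by ext k; simp [smul_comm c]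

theorem parity_apply (v : Forms r) (k : Fin 3) :
    parity r v k = (-1 : ℂ) ^ (idx k + 1).val • SPSpace.parity r (v k) := rfl

theorem parity_parity (v : Forms r) : parity r (parity r v) = v := by
  ext k
  simp [parity_apply, SPSpace.parity_parity, smul_smul, ← pow_add, ← two_mul]

theorem parity_op_smul (v : Forms r) (u : SPSpace r) :
    parity r (v <• u) = parity r v <• SPSpace.parity r u := by
  ext k
  simp [parity_apply]

theorem parity_e (j : Fin 3) : parity r (e r j) = (-1 : ℂ) ^ (idx j + 1).val • e r j := by
  ext k
  by_cases h : k = j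
  · subst h; simp [parity_apply, e_apply]
  · simp [parity_apply, e_apply, h]

theorem X_smul_e (i j : Fin 3) : X r i • e r j = ∑ k, e r k <• leftMatrix r i k j := by
  ext k
  fin_cases j <;> fin_cases k <;> simp [left_smul_apply, leftHom_X, Fin.sum_univ_three, e_apply]

/-- For homogeneous `u` the entry `(k, l)` of the matrix of `u` has parity `p(u) + idx k + idx l`.
This property passes to matrix products, since the parity of the summation index occurs twice, so
the coordinates decide it. -/
theorem parity_smul (u : SPSpace r) (v : Forms r) :
    parity r (u • v) = SPSpace.parity r u • parity r v := by
  suffices h : ∀ k l, SPSpace.parity r (leftHom r u k l) =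
      (-1 : ℂ) ^ (idx k + idx l).val • leftHom r (SPSpace.parity r u) k l by
    ext k
    simp only [parity_apply, left_smul_apply, map_sum, map_mul, h, Finset.smul_sum]
    refine Finset.sum_congr rfl fun l _ => ?_
    rw [smul_mul_assoc, mul_smul_comm, smul_smul, ← parity_add]
    congr 3
    rw [show idx k + 1 + (idx k + idx l) = (idx k + idx k) + (idx l + 1) by ring,
      CharTwo.add_self_eq_zero, zero_add]
  induction u using SPSpace.induction with
  | scalar c =>
    intro k l
    by_cases hkl : k = l
    · subst hkl; simp [CharTwo.add_self_eq_zero, Matrix.algebraMap_matrix_apply]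
    · simp [Matrix.algebraMap_matrix_apply, hkl]
  | gen i =>
    intro k l
    rw [parity_X, map_smul, leftHom_X]
    fin_cases i <;> fin_cases k <;> fin_cases l <;>
      simp [leftMatrix, parity_X, idx, ZMod.val_one, show (1 + 1 : ZMod 2) = 0 from rfl]
  | add u w hu hw =>
    intro k l
    simp [hu, hw]
  | mul u w hu hw =>
    intro k l
    simp only [map_mul, Matrix.mul_apply, map_sum, hu, hw, Finset.smul_sum]
    refine Finset.sum_congr rfl fun m _ => ?_
    rw [smul_mul_smul_comm, ← parity_add]
    congr 3
    rw [show idx k + idx m + (idx m + idx l) = (idx m + idx m) + (idx k + idx l) by ring,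
      CharTwo.add_self_eq_zero, zero_add]

/-- The grading of the one-forms. -/
noncomputable def grading (r : ℂˣ) : ZMod 2 → Submodule ℂ (Forms r) := eigenPart (parity r)

noncomputable instance : DirectSum.Decomposition (grading r) :=
  decompositionOfInvolution (parity r) parity_parity

theorem mem_grading {i : ZMod 2} {v : Forms r} :
    v ∈ grading r i ↔ parity r v = (-1 : ℂ) ^ i.val • v := mem_eigenPart

/-- The differential. -/
noncomputable def d (r : ℂˣ) : SPSpace r →ₗ[ℂ] Forms r where
  toFun u := mk fun k => leibnizHom r u (.inl k) (.inr ())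
  map_add' u v := by ext k; simp
  map_smul' c u := by ext k; simp

theorem d_apply (u : SPSpace r) (k : Fin 3) : d r u k = leibnizHom r u (.inl k) (.inr ()) := rfl

theorem d_X (j : Fin 3) : d r (X r j) = e r j := by
  ext k
  simp [d_apply, leibnizHom, lift_X, leibnizMatrix, e_apply]

/-- This is the upper right block of the multiplicativity of `leibnizHom`. -/
theorem d_mul (u v : SPSpace r) : d r (u * v) = d r u <• v + SPSpace.parity r u • d r v := by
  ext k
  simp [d_apply, Matrix.mul_apply, left_smul_apply, leibnizHom_apply, add_comm]

theorem d_algebraMap (c : ℂ) : d r (algebraMap ℂ _ c) = 0 := by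
  ext k
  simp [d_apply, Matrix.algebraMap_matrix_apply]

/-- The differential is odd on coordinates, and the Leibniz rule propagates this to products. -/
theorem parity_d (u : SPSpace r) : parity r (d r u) = -d r (SPSpace.parity r u) := by
  induction u using SPSpace.induction with
  | scalar c => simp [d_algebraMap]
  | gen i =>
    rw [parity_X, map_smul, d_X, parity_e]
    fin_cases i <;> simp [idx, ZMod.val_one, show (1 + 1 : ZMod 2) = 0 from rfl]
  | add u v hu hv => simp [hu, hv, add_comm]
  | mul u v hu hv =>
    rw [d_mul, map_mul (SPSpace.parity r), d_mul, map_add, parity_op_smul, parity_smul, hu, hv]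
    simp [add_comm]

theorem span_d : Submodule.span ℂ {w | ∃ a b c : SPSpace r, w = a • (d r b <• c)} = ⊤ := by
  rw [eq_top_iff]
  intro v _
  rw [eq_sum v]
  exact Submodule.sum_mem _ fun j _ => Submodule.subset_span ⟨1, X r j, v j, by simp [d_X]⟩

end Forms

/-- The first-order differential calculus on the quantum superspace. -/
noncomputable def calculus (r : ℂˣ) : Calculus (grading r) where
  carrier := Forms r
  grading := Forms.grading r
  smul_mem := by
    intro i j u w hu hw
    rw [grading, mem_parityPart] at hu
    rw [Forms.mem_grading] at *
    rw [Forms.parity_smul, hu, hw, smul_assoc, smul_comm u, smul_smul, parity_add]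
  op_smul_mem := by
    intro i j w u hw hu
    rw [grading, mem_parityPart] at hu
    rw [Forms.mem_grading] at *
    rw [Forms.parity_op_smul, hu, hw, parity_add]
    ext k
    simp [smul_smul, mul_comm]
  d := Forms.d r
  d_mem := by
    intro i u hu
    rw [grading, mem_parityPart] at hu
    rw [Forms.mem_grading, Forms.parity_d, hu, map_smul, parity_add, ZMod.val_one]
    simp
  leibniz := by
    intro i f hf g
    rw [grading, mem_parityPart] at hf
    rw [Forms.d_mul, hf, smul_assoc]
  span_eq_top := Forms.span_d

end SPSpace

/-! ### The graded bimodule `𝒜 ⊗ Γ` over `𝒜 ⊗ 𝒳` and its derivation -/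

theorem sign_add_left (i j k : ZMod 2) : (-1 : ℂ) ^ ((i + j).val * k.val) =
    (-1) ^ (i.val * k.val) * (-1) ^ (j.val * k.val) := by
  rw [pow_mul, parity_add, mul_pow, ← pow_mul, ← pow_mul]

theorem sign_add_right (i j k : ZMod 2) : (-1 : ℂ) ^ (i.val * (j + k).val) =
    (-1) ^ (i.val * j.val) * (-1) ^ (i.val * k.val) := by
  rw [mul_comm, sign_add_left, mul_comm j.val, mul_comm k.val]

section Homogeneous
variable {A M : Type} [AddCommGroup A] [Module ℂ A] [AddCommGroup M] [Module ℂ M]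
  (𝒜 : ZMod 2 → Submodule ℂ A) (ℳ : ZMod 2 → Submodule ℂ M)
  [DirectSum.Decomposition 𝒜] [DirectSum.Decomposition ℳ]

/-- Induction on a tensor, from tensor products of homogeneous elements. -/
theorem tmul_homogeneous_induction {P : A ⊗[ℂ] M → Prop} (zero : P 0)
    (add : ∀ s t, P s → P t → P (s + t))
    (tmul : ∀ i j, ∀ a ∈ 𝒜 i, ∀ m ∈ ℳ j, P (a ⊗ₜ m)) (s : A ⊗[ℂ] M) : P s := by
  induction s using TensorProduct.induction_on with
  | zero => exact zero
  | add s t hs ht => exact add s t hs ht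
  | tmul a m =>
    induction a using DirectSum.Decomposition.inductionOn 𝒜 with
    | zero => rwa [TensorProduct.zero_tmul]
    | add a b ha hb => rw [TensorProduct.add_tmul]; exact add _ _ ha hb
    | homogeneous a =>
      induction m using DirectSum.Decomposition.inductionOn ℳ with
      | zero => rwa [TensorProduct.tmul_zero]
      | add m n hm hn => rw [TensorProduct.tmul_add]; exact add _ _ hm hn
      | homogeneous m => exact tmul _ _ _ a.2 _ m.2

end Homogeneous

namespace Calculus
variable {A X : Type} [Ring A] [Algebra ℂ A] [Ring X] [Algebra ℂ X]
  {𝒜 : ZMod 2 → Submodule ℂ A} [GradedAlgebra 𝒜] {𝒳 : ZMod 2 → Submodule ℂ X} [GradedAlgebra 𝒳]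
  (Γ : Calculus 𝒳)

variable (𝒜) in
/-- The left action of `A ⊗ X` on `A ⊗ Γ`. -/
noncomputable def lact : 𝒜 ᵍ⊗[ℂ] 𝒳 →ₗ[ℂ] A ⊗[ℂ] Γ.carrier →ₗ[ℂ] A ⊗[ℂ] Γ.carrier :=
  leftAct 𝒜 𝒳 ∘ₗ (GradedTensorProduct.of ℂ 𝒜 𝒳).symm.toLinearMap

variable (𝒜) in
/-- The right action of `A ⊗ X` on `A ⊗ Γ`. -/
noncomputable def ract : 𝒜 ᵍ⊗[ℂ] 𝒳 →ₗ[ℂ] A ⊗[ℂ] Γ.carrier →ₗ[ℂ] A ⊗[ℂ] Γ.carrier :=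
  rightAct 𝒜 Γ.grading ∘ₗ (GradedTensorProduct.of ℂ 𝒜 𝒳).symm.toLinearMap

variable (𝒜) in
/-- The differential `τ ⊗ d` on `A ⊗ X`. -/
noncomputable def dA : 𝒜 ᵍ⊗[ℂ] 𝒳 →ₗ[ℂ] A ⊗[ℂ] Γ.carrier :=
  TensorProduct.map (signMap 𝒜) Γ.d ∘ₗ (GradedTensorProduct.of ℂ 𝒜 𝒳).symm.toLinearMap

variable (𝒜 𝒳) in
/-- The parity automorphism `τ ⊗ τ` of `A ⊗ X`. -/
noncomputable def parityA : 𝒜 ᵍ⊗[ℂ] 𝒳 →ₗ[ℂ] 𝒜 ᵍ⊗[ℂ] 𝒳 :=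
  (GradedTensorProduct.of ℂ 𝒜 𝒳).toLinearMap ∘ₗ TensorProduct.map (signMap 𝒜) (signMap 𝒳) ∘ₗ
    (GradedTensorProduct.of ℂ 𝒜 𝒳).symm.toLinearMap

theorem gtmul_induction {P : 𝒜 ᵍ⊗[ℂ] 𝒳 → Prop} (zero : P 0)
    (add : ∀ s t, P s → P t → P (s + t))
    (tmul : ∀ i j, ∀ a ∈ 𝒜 i, ∀ u ∈ 𝒳 j, P (a ᵍ⊗ₜ[ℂ] u)) (s : 𝒜 ᵍ⊗[ℂ] 𝒳) : P s :=
  tmul_homogeneous_induction 𝒜 𝒳 (P := P) zero add tmul s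

theorem lact_tmul {i j : ZMod 2} {u : X} {b : A} (hu : u ∈ 𝒳 i) (hb : b ∈ 𝒜 j) (a : A)
    (w : Γ.carrier) : Γ.lact 𝒜 (a ᵍ⊗ₜ[ℂ] u) (b ⊗ₜ[ℂ] w) =
      (-1 : ℂ) ^ (i.val * j.val) • ((a * b) ⊗ₜ[ℂ] (u • w)) :=
  leftAct_tmul 𝒜 𝒳 hu hb a w

theorem ract_tmul {i j : ZMod 2} {w : Γ.carrier} {b : A} (hw : w ∈ Γ.grading i) (hb : b ∈ 𝒜 j)
    (a : A) (u : X) : Γ.ract 𝒜 (b ᵍ⊗ₜ[ℂ] u) (a ⊗ₜ[ℂ] w) =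
      (-1 : ℂ) ^ (i.val * j.val) • ((a * b) ⊗ₜ[ℂ] (w <• u)) :=
  rightAct_tmul 𝒜 Γ.grading hw hb a u

theorem dA_tmul {i : ZMod 2} {a : A} (ha : a ∈ 𝒜 i) (u : X) :
    Γ.dA 𝒜 (a ᵍ⊗ₜ[ℂ] u) = (-1 : ℂ) ^ i.val • (a ⊗ₜ[ℂ] Γ.d u) := by
  change signMap 𝒜 a ⊗ₜ[ℂ] Γ.d u = _
  rw [signMap_of_mem 𝒜 ha, TensorProduct.smul_tmul']

theorem parityA_tmul {i j : ZMod 2} {a : A} {u : X} (ha : a ∈ 𝒜 i) (hu : u ∈ 𝒳 j) :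
    parityA 𝒜 𝒳 (a ᵍ⊗ₜ[ℂ] u) = ((-1 : ℂ) ^ i.val * (-1) ^ j.val) • (a ᵍ⊗ₜ[ℂ] u) := by
  change (signMap 𝒜 a ᵍ⊗ₜ[ℂ] signMap 𝒳 u : 𝒜 ᵍ⊗[ℂ] 𝒳) = _
  rw [signMap_of_mem 𝒜 ha, signMap_of_mem 𝒳 hu, smul_tmul', tmul_smul', smul_smul]

theorem lact_one (m : A ⊗[ℂ] Γ.carrier) : Γ.lact 𝒜 1 m = m := by
  induction m using tmul_homogeneous_induction 𝒜 Γ.grading with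
  | zero => simp
  | add m n hm hn => rw [map_add, hm, hn]
  | tmul i j a ha w hw =>
    rw [one_tmul_one, lact_tmul Γ (SetLike.GradedOne.one_mem (A := 𝒳)) ha]
    simp

theorem ract_one (m : A ⊗[ℂ] Γ.carrier) : Γ.ract 𝒜 1 m = m := by
  induction m using tmul_homogeneous_induction 𝒜 Γ.grading with
  | zero => simp
  | add m n hm hn => rw [map_add, hm, hn]
  | tmul i j a ha w hw =>
    rw [one_tmul_one, ract_tmul Γ hw (SetLike.GradedOne.one_mem (A := 𝒜))]
    simp

/-- On homogeneous tensors both sides have the same underlying tensor, and bimultiplicativity of the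
sign `(-1)^(ij)` matches the signs. The same reason gives `ract_mul` and `lact_ract`. -/
theorem lact_mul (s t : 𝒜 ᵍ⊗[ℂ] 𝒳) (m : A ⊗[ℂ] Γ.carrier) :
    Γ.lact 𝒜 (s * t) m = Γ.lact 𝒜 s (Γ.lact 𝒜 t m) := by
  induction s using gtmul_induction with
  | zero => simp
  | add s s' hs hs' => simp only [add_mul, map_add, LinearMap.add_apply, hs, hs']
  | tmul i j a ha u hu =>
  induction t using gtmul_induction with
  | zero => simp
  | add s s' hs hs' => simp only [mul_add, map_add, LinearMap.add_apply, hs, hs']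
  | tmul k l b hb v hv =>
  induction m using tmul_homogeneous_induction 𝒜 Γ.grading with
  | zero => simp
  | add m n hm hn => rw [map_add, map_add, map_add, hm, hn]
  | tmul m n c hc w hw =>
    rw [tmul_mul_tmul 𝒜 𝒳 hu hb, map_smul, LinearMap.smul_apply,
      lact_tmul Γ (SetLike.GradedMul.mul_mem hu hv) hc, lact_tmul Γ hv hc, map_smul,
      lact_tmul Γ hu (SetLike.GradedMul.mul_mem hb hc), smul_smul, smul_smul, sign_add_left,
      sign_add_right, mul_assoc a, mul_smul u v]
    congr 1
    ring

theorem ract_mul (s t : 𝒜 ᵍ⊗[ℂ] 𝒳) (m : A ⊗[ℂ] Γ.carrier) :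
    Γ.ract 𝒜 (s * t) m = Γ.ract 𝒜 t (Γ.ract 𝒜 s m) := by
  induction s using gtmul_induction with
  | zero => simp
  | add s s' hs hs' => simp only [add_mul, map_add, LinearMap.add_apply, hs, hs']
  | tmul i j a ha u hu =>
  induction t using gtmul_induction with
  | zero => simp
  | add s s' hs hs' => simp only [mul_add, map_add, LinearMap.add_apply, hs, hs']
  | tmul k l b hb v hv =>
  induction m using tmul_homogeneous_induction 𝒜 Γ.grading with
  | zero => simp
  | add m n hm hn => rw [map_add, map_add, map_add, hm, hn]
  | tmul m n c hc w hw =>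
    rw [tmul_mul_tmul 𝒜 𝒳 hu hb, map_smul, LinearMap.smul_apply,
      ract_tmul Γ hw (SetLike.GradedMul.mul_mem ha hb), ract_tmul Γ hw ha, map_smul,
      ract_tmul Γ (Γ.op_smul_mem hw hu) hb, smul_smul, smul_smul, sign_add_left,
      sign_add_right, mul_assoc c, MulOpposite.op_mul,
      mul_smul (MulOpposite.op v) (MulOpposite.op u)]
    congr 1
    ring

theorem lact_ract (s t : 𝒜 ᵍ⊗[ℂ] 𝒳) (m : A ⊗[ℂ] Γ.carrier) :
    Γ.lact 𝒜 s (Γ.ract 𝒜 t m) = Γ.ract 𝒜 t (Γ.lact 𝒜 s m) := by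
  induction s using gtmul_induction with
  | zero => simp
  | add s s' hs hs' => simp only [map_add, LinearMap.add_apply, hs, hs']
  | tmul i j a ha u hu =>
  induction t using gtmul_induction with
  | zero => simp
  | add s s' hs hs' => simp only [map_add, LinearMap.add_apply, hs, hs']
  | tmul k l b hb v hv =>
  induction m using tmul_homogeneous_induction 𝒜 Γ.grading with
  | zero => simp
  | add m n hm hn => simp only [map_add, hm, hn]
  | tmul m n c hc w hw =>
    rw [lact_tmul Γ hu hc, ract_tmul Γ hw hb, map_smul, map_smul,
      ract_tmul Γ (Γ.smul_mem hu hw) hb, lact_tmul Γ hu (SetLike.GradedMul.mul_mem hc hb),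
      smul_smul, smul_smul, sign_add_left, sign_add_right, mul_assoc a, smul_comm u]
    congr 1
    ring

/-- The factor `τ` supplies the sign for moving the odd map `d` past an element of `𝒜`, which makes
`τ ⊗ d` a graded derivation. -/
theorem dA_mul (s t : 𝒜 ᵍ⊗[ℂ] 𝒳) :
    Γ.dA 𝒜 (s * t) = Γ.ract 𝒜 t (Γ.dA 𝒜 s) + Γ.lact 𝒜 (parityA 𝒜 𝒳 s) (Γ.dA 𝒜 t) := by
  induction s using gtmul_induction with
  | zero => simp
  | add s s' hs hs' => simp only [add_mul, map_add, LinearMap.add_apply, hs, hs']; abel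
  | tmul i j a ha u hu =>
  induction t using gtmul_induction with
  | zero => simp
  | add s s' hs hs' => simp only [mul_add, map_add, LinearMap.add_apply, hs, hs']; abel
  | tmul k l b hb v hv =>
    rw [tmul_mul_tmul 𝒜 𝒳 hu hb, map_smul, dA_tmul Γ (SetLike.GradedMul.mul_mem ha hb),
      dA_tmul Γ ha, dA_tmul Γ hb, parityA_tmul ha hu, map_smul, map_smul, map_smul,
      LinearMap.smul_apply, ract_tmul Γ (Γ.d_mem hu) hb, lact_tmul Γ hu hb, Γ.leibniz hu,
      sign_add_left, parity_add, TensorProduct.tmul_add, TensorProduct.tmul_smul ((-1 : ℂ) ^ j.val)]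
    simp only [smul_add, smul_smul, ZMod.val_one, one_mul]
    congr 2 <;> ring

end Calculus

/-! ### Covariance of the nine commutation relations -/

section Covariant
variable {r : ℂˣ} {Γ : Calculus (SPSpace.grading r)}

open SPGroup SPSpace in
theorem dA_coactX (j : Fin 3) : Γ.dA (SPGroup.grading r) (coactX r j) =
    ∑ l, (-1 : ℂ) ^ (idx j + idx l).val • (T r j l ⊗ₜ[ℂ] Γ.d (X r l)) := by
  simp only [coactX, map_sum, Calculus.dA_tmul Γ (T_mem r j _)]

open SPGroup SPSpace in
theorem lact_T_X (i k j l : Fin 3) (w : Γ.carrier) :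
    Γ.lact (SPGroup.grading r) (T r i k ᵍ⊗ₜ[ℂ] X r k) (T r j l ⊗ₜ[ℂ] w) =
      (-1 : ℂ) ^ ((idx k).val * (idx j + idx l).val) • ((T r i k * T r j l) ⊗ₜ[ℂ] (X r k • w)) :=
  Calculus.lact_tmul Γ (X_mem r k) (T_mem r j l) _ _

open SPGroup SPSpace in
theorem ract_T_X (m l k n : Fin 3) :
    Γ.ract (SPGroup.grading r) (T r m l ᵍ⊗ₜ[ℂ] X r l) (T r k n ⊗ₜ[ℂ] Γ.d (X r n)) =
      (-1 : ℂ) ^ ((idx n + 1).val * (idx m + idx l).val) •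
        ((T r k n * T r m l) ⊗ₜ[ℂ] (Γ.d (X r n) <• X r l)) :=
  Calculus.ract_tmul Γ (Γ.d_mem (X_mem r n)) (T_mem r m l) _ _

-- This says that the relations between coordinates and differentials are preserved when `X_i` is
-- replaced by `δ_L(X_i)` and `dX_j` by `(τ ⊗ d)(δ_L X_j)`. It is where the relations of the quantum
-- supergroup meet those of the calculus.
open SPGroup SPSpace in
set_option maxHeartbeats 8000000 in
theorem lact_coactX_dA (h : ∀ i j, X r i • Γ.d (X r j) = ∑ k, Γ.d (X r k) <• leftMatrix r i k j)
    (i j : Fin 3) :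
    Γ.lact (SPGroup.grading r) (coactX r i) (Γ.dA (SPGroup.grading r) (coactX r j)) =
      ∑ k, Γ.ract (SPGroup.grading r) (coact r (leftMatrix r i k j))
        (Γ.dA (SPGroup.grading r) (coactX r k)) := by
  have hc : ∀ i, coact r (X r i) = coactX r i := coact_X
  fin_cases i <;> fin_cases j <;>
  simp only [dA_coactX, leftMatrix, Fin.sum_univ_three, Fin.zero_eta, Fin.mk_one, Fin.reduceFinMk,
    Matrix.of_apply, Matrix.cons_val, map_zero, map_smul, hc, LinearMap.zero_apply] <;>
  simp only [coactX, Fin.sum_univ_three, map_add, LinearMap.add_apply, map_smul,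
    LinearMap.smul_apply, lact_T_X, ract_T_X, h] <;>
  simp only [leftMatrix, Matrix.of_apply, Matrix.cons_val, MulOpposite.op_zero, zero_smul,
    MulOpposite.op_smul, smul_assoc, add_zero, zero_add] <;>
  simp only [idx, T00, T01, T02, T20, T21, T22, Matrix.cons_val, Matrix.cons_val_zero,
    Matrix.cons_val_one, add_zero, zero_add, show (1 + 1 : ZMod 2) = 0 from rfl, ZMod.val_zero,
    ZMod.val_one, mul_zero, mul_one, pow_zero, pow_one, one_smul] <;>
  -- After all coordinates are moved to the right, the identity holds with arbitrary elements in
  -- place of the nine products `dX_k · X_l`. Only the quadratic relations among the `t_ij`, with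
  -- coefficients in `r`, remain to be compared.
  generalize Γ.d (X r 0) <• X r 0 = w00 <;>
  generalize Γ.d (X r 0) <• X r 1 = w01 <;>
  generalize Γ.d (X r 0) <• X r 2 = w02 <;>
  generalize Γ.d (X r 1) <• X r 0 = w10 <;>
  generalize Γ.d (X r 1) <• X r 1 = w11 <;>
  generalize Γ.d (X r 1) <• X r 2 = w12 <;>
  generalize Γ.d (X r 2) <• X r 0 = w20 <;>
  generalize Γ.d (X r 2) <• X r 1 = w21 <;>
  generalize Γ.d (X r 2) <• X r 2 = w22 <;>
  simp only [smul_add, smul_smul, nf (r := r), nfT (r := r), TensorProduct.tmul_add,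
    TensorProduct.add_tmul, TensorProduct.tmul_smul, ← TensorProduct.smul_tmul'] <;>
  simp only [q] <;>
  match_scalars <;> field_simp <;> ring_nf
end Covariant

/-! ### A generator criterion for coactions -/

theorem pow_apply_of_sign {N : Type} [AddCommGroup N] [Module ℂ N] {σ : N →ₗ[ℂ] N} {i : ZMod 2} {w : N}
    (h : σ w = (-1 : ℂ) ^ i.val • w) (n : ℕ) : (σ ^ n) w = (-1 : ℂ) ^ (i.val * n) • w := by
  induction n with
  | zero => simp
  | succ n ih =>
    rw [pow_succ', Module.End.mul_apply, ih, map_smul, h, smul_smul, mul_add, pow_add, mul_one]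

section Comodule
open SPGroup SPSpace
variable {r : ℂˣ} {N : Type} [AddCommGroup N] [Module ℂ N] [Module (SPSpace r)ᵐᵒᵖ N]
  [IsScalarTower ℂ (SPSpace r)ᵐᵒᵖ N]

theorem op_smul_mem_of_X {S : Submodule ℂ N} (h : ∀ w ∈ S, ∀ k, w <• X r k ∈ S) (u : SPSpace r) :
    ∀ w ∈ S, w <• u ∈ S := by
  induction u using SPSpace.induction with
  | scalar c =>
    intro w hw
    have : w <• algebraMap ℂ (SPSpace r) c = c • w := by
      rw [Algebra.algebraMap_eq_smul_one, MulOpposite.op_smul, smul_assoc, MulOpposite.op_one,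
        one_smul]
    rw [this]
    exact S.smul_mem c hw
  | gen i => exact fun w hw => h w hw i
  | add u v hu hv =>
    intro w hw
    rw [MulOpposite.op_add, add_smul]
    exact S.add_mem (hu w hw) (hv w hw)
  | mul u v hu hv =>
    intro w hw
    rw [MulOpposite.op_mul, mul_smul (MulOpposite.op v) (MulOpposite.op u)]
    exact hv _ (hu w hw)

variable (r N) in
/-- Right multiplication by the coordinate `X_l`. -/
noncomputable def rmul (l : Fin 3) : N →ₗ[ℂ] N := Algebra.lsmul ℂ ℂ N (MulOpposite.op (X r l))

variable (r) in
/-- Right multiplication by `t_kl ⊗ X_l`, where `σ` is the parity automorphism of `N`. -/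
noncomputable def step (σ : N →ₗ[ℂ] N) (k l : Fin 3) :
    SPGroup r ⊗[ℂ] N →ₗ[ℂ] SPGroup r ⊗[ℂ] N :=
  -- By `pow_apply_of_sign` the power of `σ` multiplies a homogeneous `w` by the sign for moving it
  -- past `t_kl`. The sign thus becomes a linear operator, and no splitting into homogeneous parts
  -- is needed.
  TensorProduct.map (LinearMap.mulRight ℂ (T r k l)) (rmul r N l ∘ₗ σ ^ (idx k + idx l).val)

theorem symm_mul_T (s : SPGroup.grading r ᵍ⊗[ℂ] SPGroup.grading r) (k m l : Fin 3) :
    (GradedTensorProduct.of ℂ (SPGroup.grading r) (SPGroup.grading r)).symm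
        (s * (T r k m ᵍ⊗ₜ[ℂ] T r m l)) =
      TensorProduct.map (LinearMap.mulRight ℂ (T r k m))
        (LinearMap.mulRight ℂ (T r m l) ∘ₗ signMap (SPGroup.grading r) ^ (idx k + idx m).val)
        ((GradedTensorProduct.of ℂ (SPGroup.grading r) (SPGroup.grading r)).symm s) := by
  induction s using Calculus.gtmul_induction with
  | zero => simp
  | add s t hs ht => simp only [add_mul, map_add, hs, ht]
  | tmul i j a ha b hb =>
    rw [tmul_mul_tmul _ _ hb (T_mem r k m), map_smul]
    change _ • ((a * T r k m) ⊗ₜ[ℂ] (b * T r m l)) =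
      (a * T r k m) ⊗ₜ[ℂ] ((signMap (SPGroup.grading r) ^ (idx k + idx m).val) b * T r m l)
    rw [pow_apply_of_sign (signMap_of_mem _ hb), smul_mul_assoc, TensorProduct.tmul_smul]

variable (r) in
/-- The comultiplication as a map into the tensor product of vector spaces. -/
noncomputable def comulLin : SPGroup r →ₗ[ℂ] SPGroup r ⊗[ℂ] SPGroup r :=
  (GradedTensorProduct.of ℂ (SPGroup.grading r) (SPGroup.grading r)).symm.toLinearMap ∘ₗ
    (comul r).toLinearMap

theorem comulLin_T (k l : Fin 3) : comulLin r (T r k l) = ∑ m, T r k m ⊗ₜ[ℂ] T r m l := by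
  change (GradedTensorProduct.of ℂ (SPGroup.grading r) (SPGroup.grading r)).symm
    (comul r (T r k l)) = _
  rw [comul_T, map_sum]
  rfl

theorem comulLin_mul_T (a : SPGroup r) (k l : Fin 3) : comulLin r (a * T r k l) =
    ∑ m, TensorProduct.map (LinearMap.mulRight ℂ (T r k m))
        (LinearMap.mulRight ℂ (T r m l) ∘ₗ signMap (SPGroup.grading r) ^ (idx k + idx m).val)
        (comulLin r a) := by
  change (GradedTensorProduct.of ℂ (SPGroup.grading r) (SPGroup.grading r)).symm
    (comul r (a * T r k l)) = _
  rw [map_mul, comul_T, Finset.mul_sum, map_sum]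
  exact Finset.sum_congr rfl fun m _ => symm_mul_T _ _ _ _

theorem pow_idx {σ : N →ₗ[ℂ] N} (hσ : ∀ w, σ (σ w) = w) (i j k : ZMod 2) (w : N) :
    (σ ^ (i + j).val) ((σ ^ (k + i).val) w) = (σ ^ (k + j).val) w := by
  have h2 : σ ^ 2 = 1 := by
    ext w
    simp [pow_two, hσ]
  have h (i : ZMod 2) : (i = 0 ∧ i.val = 0) ∨ (i = 1 ∧ i.val = 1) := by revert i; decide
  rw [← Module.End.mul_apply, ← pow_add]
  congr 1
  rw [pow_eq_pow_mod _ h2, pow_eq_pow_mod (k + j).val h2]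
  congr 1
  revert i j k
  decide

variable {σ : N →ₗ[ℂ] N} {ρ : N →ₗ[ℂ] SPGroup r ⊗[ℂ] N}

/-- A map that is multiplicative over the left coaction is coassociative and counital, if it is so
on generators. -/
theorem isLeftCoaction_of_generators (hσ : ∀ w, σ (σ w) = w)
    (hρσ : ∀ w, ρ (σ w) = TensorProduct.map (signMap (SPGroup.grading r)) σ (ρ w))
    (hρ : ∀ w k, ρ (w <• X r k) = ∑ l, step r σ k l (ρ w)) {G : Set N}
    (hG : ∀ S : Submodule ℂ N, G ⊆ S → (∀ w ∈ S, ∀ k, w <• X r k ∈ S) → S = ⊤)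
    (hc : ∀ g ∈ G, ρ.lTensor _ (ρ g) =
      TensorProduct.assoc ℂ _ _ N ((comulLin r).rTensor N (ρ g)))
    (hε : ∀ g ∈ G, TensorProduct.lid ℂ N ((counit r).toLinearMap.rTensor N (ρ g)) = g) :
    IsLeftCoaction (comulLin r) (counit r).toLinearMap ρ := by
  have hρσn (n : ℕ) (w : N) : ρ ((σ ^ n) w) =
      TensorProduct.map (signMap (SPGroup.grading r) ^ n) (σ ^ n) (ρ w) := by
    induction n with
    | zero => simp
    | succ n ih =>
      rw [pow_succ', Module.End.mul_apply, hρσ, ih, pow_succ', Module.End.mul_eq_comp,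
        Module.End.mul_eq_comp, TensorProduct.map_comp]
      rfl
  -- Right multiplication by `t_kl ⊗ t_lm ⊗ X_m`. The second factor passes `t_kl`; the third passes
  -- both `t_kl` and `t_lm`, of total parity `idx k + idx m`.
  let C (k l m : Fin 3) : SPGroup r ⊗[ℂ] (SPGroup r ⊗[ℂ] N) →ₗ[ℂ] SPGroup r ⊗[ℂ] (SPGroup r ⊗[ℂ] N) :=
    TensorProduct.map (LinearMap.mulRight ℂ (T r k l)) (TensorProduct.map
      (LinearMap.mulRight ℂ (T r l m) ∘ₗ signMap (SPGroup.grading r) ^ (idx k + idx l).val)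
      (rmul r N m ∘ₗ σ ^ (idx k + idx m).val))
  have hF (k l : Fin 3) (z : SPGroup r ⊗[ℂ] N) :
      ρ.lTensor _ (step r σ k l z) = ∑ m, C k l m (ρ.lTensor _ z) := by
    induction z using TensorProduct.induction_on with
    | zero => simp
    | add y z hy hz => simp only [map_add, hy, hz, Finset.sum_add_distrib]
    | tmul a w =>
      change (a * T r k l) ⊗ₜ[ℂ] ρ ((σ ^ (idx k + idx l).val) w <• X r l) =
        ∑ m, (a * T r k l) ⊗ₜ[ℂ] (TensorProduct.map
          (LinearMap.mulRight ℂ (T r l m) ∘ₗ signMap (SPGroup.grading r) ^ (idx k + idx l).val)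
          (rmul r N m ∘ₗ σ ^ (idx k + idx m).val)) (ρ w)
      rw [hρ, hρσn, ← TensorProduct.tmul_sum]
      congr 1
      refine Finset.sum_congr rfl fun m _ => ?_
      rw [step, ← LinearMap.comp_apply, ← TensorProduct.map_comp]
      congr 2
      ext w
      simp only [LinearMap.comp_apply, pow_idx hσ]
  have hGC (k l : Fin 3) (z : SPGroup r ⊗[ℂ] N) :
      TensorProduct.assoc ℂ _ _ N ((comulLin r).rTensor N (step r σ k l z)) =
        ∑ m, C k m l (TensorProduct.assoc ℂ _ _ N ((comulLin r).rTensor N z)) := by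
    induction z using TensorProduct.induction_on with
    | zero => simp
    | add y z hy hz => simp only [map_add, hy, hz, Finset.sum_add_distrib]
    | tmul a w =>
      change TensorProduct.assoc ℂ _ _ N (comulLin r (a * T r k l) ⊗ₜ[ℂ]
        ((σ ^ (idx k + idx l).val) w <• X r l)) =
        ∑ m, C k m l (TensorProduct.assoc ℂ _ _ N (comulLin r a ⊗ₜ[ℂ] w))
      rw [comulLin_mul_T, TensorProduct.sum_tmul, map_sum]
      refine Finset.sum_congr rfl fun m _ => ?_
      induction comulLin r a using TensorProduct.induction_on with
      | zero => simp
      | add y z hy hz => simp only [map_add, TensorProduct.add_tmul, hy, hz]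
      | tmul b c => rfl
  constructor
  -- The locus where the two sides agree is a subspace containing `G`; it is everything once it is
  -- stable under right multiplication by the coordinates.
  · refine LinearMap.eqLocus_eq_top.1 (hG _ (fun g hg => hc g hg) ?_)
    intro w hw k
    have hw' : ρ.lTensor _ (ρ w) = TensorProduct.assoc ℂ _ _ N ((comulLin r).rTensor N (ρ w)) := hw
    change ρ.lTensor _ (ρ (w <• X r k)) =
      TensorProduct.assoc ℂ _ _ N ((comulLin r).rTensor N (ρ (w <• X r k)))
    simp only [hρ, map_sum, hF, hGC, hw']
    -- One side is the double sum of `C k l m`, the other that of `C k m l`, so they differ by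
    -- renaming the indices.
    exact Finset.sum_comm
  · refine LinearMap.eqLocus_eq_top.1 (hG _ (fun g hg => hε g hg) ?_)
    intro w hw k
    have hw' : TensorProduct.lid ℂ N ((counit r).toLinearMap.rTensor N (ρ w)) = w := hw
    -- The counit kills `t_kl` unless `k = l`, and the diagonal entries are even, so no sign
    -- survives.
    have hK (l : Fin 3) (z : SPGroup r ⊗[ℂ] N) :
        TensorProduct.lid ℂ N ((counit r).toLinearMap.rTensor N (step r σ k l z)) =
          if k = l then TensorProduct.lid ℂ N ((counit r).toLinearMap.rTensor N z) <• X r k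
          else 0 := by
      induction z using TensorProduct.induction_on with
      | zero => simp
      | add y z hy hz => simp only [map_add, hy, hz]; split_ifs <;> simp
      | tmul a w =>
        change counit r (a * T r k l) • ((σ ^ (idx k + idx l).val) w <• X r l) =
          if k = l then (counit r a • w) <• X r k else 0
        rw [map_mul, counit_T]
        split_ifs with h
        · subst h
          rw [CharTwo.add_self_eq_zero, smul_comm (MulOpposite.op _)]
          simp
        · simp
    change TensorProduct.lid ℂ N ((counit r).toLinearMap.rTensor N (ρ (w <• X r k))) = w <• X r k
    simp only [hρ, map_sum, hK, hw']
    simp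

end Comodule

/-! ### The coaction on the quantum superspace -/

open SPGroup SPSpace
variable {r : ℂˣ}

theorem parityA_mul {A X : Type} [Ring A] [Algebra ℂ A] [Ring X] [Algebra ℂ X]
    {𝒜 : ZMod 2 → Submodule ℂ A} [GradedAlgebra 𝒜] {𝒳 : ZMod 2 → Submodule ℂ X} [GradedAlgebra 𝒳]
    (s t : 𝒜 ᵍ⊗[ℂ] 𝒳) : Calculus.parityA 𝒜 𝒳 (s * t) =
      Calculus.parityA 𝒜 𝒳 s * Calculus.parityA 𝒜 𝒳 t := by
  induction s using Calculus.gtmul_induction with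
  | zero => simp
  | add s s' hs hs' => simp only [add_mul, map_add, hs, hs']
  | tmul i j a ha u hu =>
  induction t using Calculus.gtmul_induction with
  | zero => simp
  | add s s' hs hs' => simp only [mul_add, map_add, hs, hs']
  | tmul k l b hb v hv =>
    rw [tmul_mul_tmul 𝒜 𝒳 hu hb, map_smul, Calculus.parityA_tmul ha hu,
      Calculus.parityA_tmul hb hv, smul_mul_smul_comm, tmul_mul_tmul 𝒜 𝒳 hu hb,
      Calculus.parityA_tmul (SetLike.GradedMul.mul_mem ha hb) (SetLike.GradedMul.mul_mem hu hv),
      parity_add, parity_add, smul_smul, smul_smul]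
    congr 1
    ring

theorem parity_of_mem {i : ZMod 2} {u : SPSpace r} (hu : u ∈ SPSpace.grading r i) :
    SPSpace.parity r u = (-1 : ℂ) ^ i.val • u :=
  mem_parityPart.1 hu

/-- Every summand `t_il ⊗ X_l` of `δ_L(X_i)` has the parity of `X_i`, and both parity maps are
multiplicative. -/
theorem coact_parity (u : SPSpace r) : coact r (SPSpace.parity r u) =
    Calculus.parityA (SPGroup.grading r) (SPSpace.grading r) (coact r u) := by
  have h1 : Calculus.parityA (SPGroup.grading r) (SPSpace.grading r) 1 = 1 := by
    rw [one_tmul_one, Calculus.parityA_tmul (SetLike.GradedOne.one_mem (A := SPGroup.grading r))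
      (SetLike.GradedOne.one_mem (A := SPSpace.grading r))]
    simp
  induction u using SPSpace.induction with
  | scalar c =>
    rw [AlgHom.commutes, AlgHom.commutes, Algebra.algebraMap_eq_smul_one, map_smul, h1]
  | gen i =>
    rw [parity_X, map_smul, coact_X, map_sum, Finset.smul_sum]
    refine Finset.sum_congr rfl fun l _ => ?_
    rw [Calculus.parityA_tmul (T_mem r i l) (X_mem r l), ← parity_add, add_assoc,
      CharTwo.add_self_eq_zero, add_zero]
  | add u v hu hv => simp only [map_add, hu, hv]
  | mul u v hu hv => simp only [map_mul, parityA_mul, hu, hv]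

variable (r) in
/-- The left coaction as a map into the tensor product of vector spaces. -/
noncomputable def coactLin : SPSpace r →ₗ[ℂ] SPGroup r ⊗[ℂ] SPSpace r :=
  (GradedTensorProduct.of ℂ (SPGroup.grading r) (SPSpace.grading r)).symm.toLinearMap ∘ₗ
    (coact r).toLinearMap

theorem signMap_eq_parity : signMap (SPSpace.grading r) = (SPSpace.parity r).toLinearMap := by
  ext u
  induction u using DirectSum.Decomposition.inductionOn (SPSpace.grading r) with
  | zero => simp
  | add u v hu hv => rw [map_add, map_add, hu, hv]
  | homogeneous u => rw [signMap_of_mem _ u.2, AlgHom.toLinearMap_apply, parity_of_mem u.2]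

theorem symm_mul_T_X (s : SPGroup.grading r ᵍ⊗[ℂ] SPSpace.grading r) (k l : Fin 3) :
    (GradedTensorProduct.of ℂ (SPGroup.grading r) (SPSpace.grading r)).symm
        (s * (T r k l ᵍ⊗ₜ[ℂ] X r l)) =
      step r (SPSpace.parity r).toLinearMap k l
        ((GradedTensorProduct.of ℂ (SPGroup.grading r) (SPSpace.grading r)).symm s) := by
  induction s using Calculus.gtmul_induction with
  | zero => simp
  | add s t hs ht => simp only [add_mul, map_add, hs, ht]
  | tmul i j a ha u hu =>
    rw [tmul_mul_tmul _ _ hu (T_mem r k l), map_smul]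
    change _ • ((a * T r k l) ⊗ₜ[ℂ] (u * X r l)) = (a * T r k l) ⊗ₜ[ℂ]
      (((SPSpace.parity r).toLinearMap ^ (idx k + idx l).val) u * X r l)
    rw [pow_apply_of_sign (σ := (SPSpace.parity r).toLinearMap) (parity_of_mem hu), smul_mul_assoc,
      TensorProduct.tmul_smul]

/-- The criterion applies with the single generator `1` of `𝒳` as a right module over itself. -/
theorem isLeftCoaction_coact :
    IsLeftCoaction (comulLin r) (counit r).toLinearMap (coactLin r) := by
  have h1 : coactLin r 1 = 1 ⊗ₜ 1 := by
    change (GradedTensorProduct.of ℂ (SPGroup.grading r) (SPSpace.grading r)).symm (coact r 1) = _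
    rw [map_one]
    rfl
  have hΔ : comulLin r 1 = 1 ⊗ₜ 1 := by
    change (GradedTensorProduct.of ℂ (SPGroup.grading r) (SPGroup.grading r)).symm (comul r 1) = _
    rw [map_one]
    rfl
  refine isLeftCoaction_of_generators (σ := (SPSpace.parity r).toLinearMap) (G := {1})
    (SPSpace.parity_parity r) ?_ ?_ ?_ ?_ ?_
  · intro w
    change (GradedTensorProduct.of ℂ (SPGroup.grading r) (SPSpace.grading r)).symm
      (coact r (SPSpace.parity r w)) = _
    rw [coact_parity, Calculus.parityA, signMap_eq_parity]
    rfl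
  · intro w k
    change (GradedTensorProduct.of ℂ (SPGroup.grading r) (SPSpace.grading r)).symm
      (coact r (w * X r k)) = _
    rw [map_mul, coact_X, Finset.mul_sum, map_sum]
    exact Finset.sum_congr rfl fun l _ => symm_mul_T_X _ _ _
  · intro S h hS
    rw [eq_top_iff]
    intro u _
    simpa using op_smul_mem_of_X hS u 1 (h rfl)
  · rintro _ rfl
    simp [h1, hΔ]
  · rintro _ rfl
    simp [h1]

/-! ### The coaction on one-forms -/

section Covariant
variable (Γ : Calculus (SPSpace.grading r))

/-- The parity automorphism of the one-forms of a calculus. -/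
noncomputable def Calculus.sign : Γ.carrier →ₗ[ℂ] Γ.carrier :=
  ∑ i, (-1 : ℂ) ^ i.val • proj Γ.grading i

theorem sign_of_mem {i : ZMod 2} {w : Γ.carrier} (hw : w ∈ Γ.grading i) :
    Γ.sign w = (-1 : ℂ) ^ i.val • w := by
  simp [Calculus.sign, proj_of_mem Γ.grading hw]

theorem sign_sign (w : Γ.carrier) : Γ.sign (Γ.sign w) = w := by
  induction w using DirectSum.Decomposition.inductionOn Γ.grading with
  | zero => simp
  | add u v hu hv => rw [map_add, map_add, hu, hv]
  | homogeneous w =>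
    rw [sign_of_mem Γ w.2, map_smul, sign_of_mem Γ w.2, smul_smul, ← parity_add,
      CharTwo.add_self_eq_zero]
    simp

theorem sign_op_smul (w : Γ.carrier) (u : SPSpace r) :
    Γ.sign (w <• u) = Γ.sign w <• SPSpace.parity r u := by
  induction w using DirectSum.Decomposition.inductionOn Γ.grading with
  | zero => simp
  | add v w hv hw => rw [smul_add, map_add, map_add, hv, hw, smul_add]
  | homogeneous w =>
    induction u using DirectSum.Decomposition.inductionOn (SPSpace.grading r) with
    | zero => simp
    | add u v hu hv =>
      rw [map_add, MulOpposite.op_add, MulOpposite.op_add, add_smul, add_smul, map_add, hu, hv]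
    | homogeneous u =>
      rw [sign_of_mem Γ (Γ.op_smul_mem w.2 u.2), sign_of_mem Γ w.2, parity_of_mem u.2, parity_add,
        MulOpposite.op_smul, smul_assoc, smul_comm (MulOpposite.op _), smul_smul, mul_comm]

theorem map_sign_ract (s : SPGroup.grading r ᵍ⊗[ℂ] SPSpace.grading r)
    (m : SPGroup r ⊗[ℂ] Γ.carrier) :
    TensorProduct.map (signMap (SPGroup.grading r)) Γ.sign (Γ.ract (SPGroup.grading r) s m) =
      Γ.ract (SPGroup.grading r) (Calculus.parityA _ _ s)
        (TensorProduct.map (signMap (SPGroup.grading r)) Γ.sign m) := by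
  induction s using Calculus.gtmul_induction with
  | zero => simp
  | add s s' hs hs' => simp only [map_add, LinearMap.add_apply, hs, hs']
  | tmul i j a ha u hu =>
  induction m using tmul_homogeneous_induction (SPGroup.grading r) Γ.grading with
  | zero => simp
  | add m n hm hn => simp only [map_add, hm, hn]
  | tmul k l b hb w hw =>
    rw [Calculus.ract_tmul Γ hw ha, Calculus.parityA_tmul ha hu, map_smul,
      TensorProduct.map_tmul, TensorProduct.map_tmul,
      signMap_of_mem _ (SetLike.GradedMul.mul_mem hb ha), signMap_of_mem _ hb, sign_of_mem Γ hw,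
      sign_of_mem Γ (Γ.op_smul_mem hw hu), TensorProduct.smul_tmul_smul,
      TensorProduct.smul_tmul_smul, map_smul, map_smul, LinearMap.smul_apply,
      Calculus.ract_tmul Γ hw ha, parity_add, parity_add, smul_smul, smul_smul, smul_smul]
    congr 1
    ring

theorem ract_T_X_eq_step (k l : Fin 3) (z : SPGroup r ⊗[ℂ] Γ.carrier) :
    Γ.ract (SPGroup.grading r) (T r k l ᵍ⊗ₜ[ℂ] X r l) z = step r Γ.sign k l z := by
  induction z using tmul_homogeneous_induction (SPGroup.grading r) Γ.grading with
  | zero => simp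
  | add m n hm hn => simp only [map_add, hm, hn]
  | tmul i j a ha w hw =>
    rw [Calculus.ract_tmul Γ hw (T_mem r k l)]
    change _ = (a * T r k l) ⊗ₜ[ℂ] ((Γ.sign ^ (idx k + idx l).val) w <• X r l)
    rw [pow_apply_of_sign (sign_of_mem Γ hw), smul_comm (MulOpposite.op _),
      TensorProduct.tmul_smul ((-1 : ℂ) ^ _)]

variable (B : Module.Basis (Fin 3) (SPSpace r)ᵐᵒᵖ Γ.carrier)

/-- The coordinates of a one-form, as a linear map over `ℂ`. -/
noncomputable def coordLin (j : Fin 3) : Γ.carrier →ₗ[ℂ] SPSpace r :=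
  (MulOpposite.opLinearEquiv ℂ).symm.toLinearMap ∘ₗ (B.coord j).restrictScalars ℂ

theorem coordLin_op_smul (j : Fin 3) (w : Γ.carrier) (u : SPSpace r) :
    coordLin Γ B j (w <• u) = coordLin Γ B j w * u := by
  simp [coordLin]

theorem coordLin_basis (j k : Fin 3) : coordLin Γ B j (B k) = if k = j then 1 else 0 := by
  by_cases h : k = j
  · subst h; simp [coordLin]
  · simp [coordLin, h]

theorem sum_coordLin (w : Γ.carrier) : ∑ j, B j <• coordLin Γ B j w = w := B.sum_repr w

/-- The left coaction on the one-forms. -/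
noncomputable def coactForms : Γ.carrier →ₗ[ℂ] SPGroup r ⊗[ℂ] Γ.carrier :=
  ∑ j, (Γ.ract (SPGroup.grading r)).flip (Γ.dA (SPGroup.grading r) (coactX r j)) ∘ₗ
    (coact r).toLinearMap ∘ₗ coordLin Γ B j

theorem coactForms_apply (w : Γ.carrier) : coactForms Γ B w =
    ∑ j, Γ.ract (SPGroup.grading r) (coact r (coordLin Γ B j w))
      (Γ.dA (SPGroup.grading r) (coactX r j)) := by
  simp [coactForms]

theorem coactForms_op_smul (w : Γ.carrier) (u : SPSpace r) :
    coactForms Γ B (w <• u) = Γ.ract (SPGroup.grading r) (coact r u) (coactForms Γ B w) := by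
  simp only [coactForms_apply, coordLin_op_smul, map_mul, Calculus.ract_mul, map_sum]

theorem coactForms_basis (j : Fin 3) :
    coactForms Γ B (B j) = Γ.dA (SPGroup.grading r) (coactX r j) := by
  rw [coactForms_apply, Finset.sum_eq_single j]
  · rw [coordLin_basis, if_pos rfl, map_one, Calculus.ract_one]
  · intro k _ hk
    rw [coordLin_basis, if_neg hk.symm, map_zero, map_zero, LinearMap.zero_apply]
  · simp

variable (hB : ∀ i, B i = Γ.d (X r i))
  (h : ∀ i j, X r i • Γ.d (X r j) = ∑ k, Γ.d (X r k) <• leftMatrix r i k j)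
include hB

/-- Every summand `t_jl ⊗ dX_l` has parity `idx j + 1`, that of `dX_j`; right multiplicativity
extends this from the basis to all forms. -/
theorem coactForms_sign (w : Γ.carrier) : coactForms Γ B (Γ.sign w) =
    TensorProduct.map (signMap (SPGroup.grading r)) Γ.sign (coactForms Γ B w) := by
  rw [← sum_coordLin Γ B w]
  simp only [map_sum]
  refine Finset.sum_congr rfl fun j _ => ?_
  rw [sign_op_smul, coactForms_op_smul, coactForms_op_smul, map_sign_ract, coact_parity]
  congr 1
  have hX (l : Fin 3) : Γ.d (X r l) ∈ Γ.grading (idx l + 1) := Γ.d_mem (X_mem r l)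
  rw [coactForms_basis, hB, sign_of_mem Γ (hX j), map_smul, ← hB, coactForms_basis, dA_coactX,
    map_sum, Finset.smul_sum]
  refine Finset.sum_congr rfl fun l _ => ?_
  rw [map_smul, TensorProduct.map_tmul, signMap_of_mem _ (T_mem r j l), sign_of_mem Γ (hX l),
    TensorProduct.smul_tmul_smul, smul_smul, smul_smul, ← parity_add, ← parity_add, ← parity_add]
  congr 3
  generalize idx j = i
  generalize idx l = k
  revert i k
  decide

theorem isLeftCoaction_coactForms :
    IsLeftCoaction (comulLin r) (counit r).toLinearMap (coactForms Γ B) := by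
  refine isLeftCoaction_of_generators (σ := Γ.sign) (G := Set.range B)
    (sign_sign Γ) (coactForms_sign Γ B hB) ?_ ?_ ?_ ?_
  · intro w k
    rw [coactForms_op_smul, coact_X, map_sum, LinearMap.sum_apply]
    exact Finset.sum_congr rfl fun l _ => ract_T_X_eq_step Γ _ _ _
  · intro S hS hX
    rw [eq_top_iff]
    intro w _
    rw [← sum_coordLin Γ B w]
    exact S.sum_mem fun j _ => op_smul_mem_of_X hX _ _ (hS ⟨j, rfl⟩)
  · rintro _ ⟨j, rfl⟩
    simp only [coactForms_basis, dA_coactX, map_sum, map_smul, LinearMap.lTensor_tmul, ← hB,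
      LinearMap.rTensor_tmul, comulLin_T, TensorProduct.sum_tmul, TensorProduct.assoc_tmul,
      TensorProduct.tmul_sum, TensorProduct.tmul_smul, Finset.smul_sum, smul_smul, ← parity_add]
    rw [Finset.sum_comm]
    refine Finset.sum_congr rfl fun l _ => Finset.sum_congr rfl fun k _ => ?_
    -- The sign of `t_jl` is the product of the signs of `t_jk` and `t_kl`, so `τ` respects the
    -- matrix coproduct.
    congr 3
    generalize idx j = i
    generalize idx l = k
    generalize idx _ = l
    revert i k l
    decide
  · rintro _ ⟨j, rfl⟩
    simp only [coactForms_basis, dA_coactX, map_sum, map_smul, ← hB, LinearMap.rTensor_tmul,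
      TensorProduct.lid_tmul, AlgHom.toLinearMap_apply, counit_T]
    rw [Finset.sum_eq_single j]
    · simp [CharTwo.add_self_eq_zero]
    · intro l _ hl
      simp [hl.symm]
    · simp

include h

/-- The statement is for all `w` at once, so that products of left factors can be peeled off one by
one. For a coordinate, right coefficients are stripped because the two actions commute, leaving
`lact_coactX_dA`. -/
theorem coactForms_smul (u : SPSpace r) : ∀ w : Γ.carrier, coactForms Γ B (u • w) =
    Γ.lact (SPGroup.grading r) (coact r u) (coactForms Γ B w) := by
  induction u using SPSpace.induction with
  | scalar c =>
    intro w
    rw [AlgHom.commutes, Algebra.algebraMap_eq_smul_one, Algebra.algebraMap_eq_smul_one,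
      smul_assoc, one_smul, map_smul, map_smul, LinearMap.smul_apply, Calculus.lact_one]
  | gen i =>
    intro w
    rw [← sum_coordLin Γ B w]
    simp only [Finset.smul_sum, map_sum]
    refine Finset.sum_congr rfl fun j _ => ?_
    rw [smul_comm (X r i), coactForms_op_smul, coactForms_op_smul, Calculus.lact_ract]
    congr 1
    rw [hB, h, map_sum, ← hB, coactForms_basis, show coact r (X r i) = coactX r i from coact_X i,
      lact_coactX_dA h]
    refine Finset.sum_congr rfl fun k _ => ?_
    rw [coactForms_op_smul, ← hB, coactForms_basis]
  | add u v hu hv =>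
    intro w
    simp only [add_smul, map_add, hu, hv, LinearMap.add_apply]
  | mul u v hu hv =>
    intro w
    rw [mul_smul u v, hu, hv, map_mul, Calculus.lact_mul]

/-- Both sides obey the same twisted Leibniz rule, by multiplicativity of the coaction on one side
and by `Calculus.dA_mul` with `coact_parity` on the other, and they agree on coordinates. -/
theorem coactForms_d (u : SPSpace r) :
    coactForms Γ B (Γ.d u) = Γ.dA (SPGroup.grading r) (coact r u) := by
  have hd (u v : SPSpace r) : Γ.d (u * v) = Γ.d u <• v + SPSpace.parity r u • Γ.d v := by
    induction u using DirectSum.Decomposition.inductionOn (SPSpace.grading r) with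
    | zero => simp
    | add u u' hu hu' => simp only [add_mul, map_add, smul_add, add_smul, hu, hu']; abel
    | homogeneous u => rw [Γ.leibniz u.2, parity_of_mem u.2, smul_assoc]
  induction u using SPSpace.induction with
  | scalar c =>
    -- The Leibniz rule for `1 · 1` gives `d 1 = d 1 + d 1`.
    have h1 : Γ.d 1 = 0 := by simpa using hd 1 1
    have h1' : Γ.dA (SPGroup.grading r) (1 : SPGroup.grading r ᵍ⊗[ℂ] SPSpace.grading r) = 0 := by
      rw [one_tmul_one, Calculus.dA_tmul Γ (SetLike.GradedOne.one_mem (A := SPGroup.grading r)),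
        h1, TensorProduct.tmul_zero, smul_zero]
    rw [AlgHom.commutes, Algebra.algebraMap_eq_smul_one, Algebra.algebraMap_eq_smul_one, map_smul,
      map_smul, map_smul, h1, h1', map_zero]
  | gen i => rw [← hB, coactForms_basis, show coact r (X r i) = coactX r i from coact_X i]
  | add u v hu hv => simp only [map_add, hu, hv]
  | mul u v hu hv =>
    rw [hd, map_add, coactForms_op_smul, coactForms_smul Γ B hB h, hu, hv, map_mul,
      Calculus.dA_mul, coact_parity]

theorem isLeftCovariant_of_basis : Γ.IsLeftCovariant (comul r) (counit r) (coact r) :=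
  ⟨isLeftCoaction_coact, coactForms Γ B, isLeftCoaction_coactForms Γ B hB,
    coactForms_smul Γ B hB h, coactForms_op_smul Γ B, coactForms_d Γ B hB h⟩

end Covariant
end QSP

/-! ### The proposition -/

theorem proposition4 (q : ℂ) (r : ℂˣ) (hq : q = (r : ℂ) ^ 2) :
    ∃ Γ : QSP.Calculus (QSP.SPSpace.grading r),
      Γ.IsLeftCovariant (QSP.SPGroup.comul r) (QSP.SPGroup.counit r) (QSP.coact r) ∧
      (∃ B : Module.Basis (Fin 3) (QSP.SPSpace r)ᵐᵒᵖ Γ.carrier, ∀ i, B i = Γ.d (QSP.SPSpace.X r i)) ∧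
      let ξ : QSP.SPSpace r := QSP.SPSpace.X r 0
      let x : QSP.SPSpace r := QSP.SPSpace.X r 1
      let η : QSP.SPSpace r := QSP.SPSpace.X r 2
      let dξ : Γ.carrier := Γ.d ξ
      let dx : Γ.carrier := Γ.d x
      let dη : Γ.carrier := Γ.d η
      x • dx = q • (dx <• x) + ((r : ℂ) * (q ^ 2 - 1)) • (dη <• ξ) ∧
      x • dξ = q • (dξ <• x) + (q ^ 2 - 1) • (dx <• ξ) ∧
      x • dη = q • (dη <• x) ∧
      ξ • dx = -q • (dx <• ξ) ∧
      ξ • dξ = dξ <• ξ ∧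
      ξ • dη = q ^ 2 • (dη <• ξ) ∧
      η • dx = -q • (dx <• η) + (1 - q ^ 2) • (dη <• x) ∧
      η • dξ = q ^ 2 • (dξ <• η) + (1 - q ^ 2) • ((1 + q) • (dη <• ξ) - (r : ℂ) • (dx <• x)) ∧
      η • dη = dη <• η := by
  obtain rfl : q = QSP.q r := hq
  have hB (i : Fin 3) : QSP.SPSpace.Forms.basis r i =
      (QSP.SPSpace.calculus r).d (QSP.SPSpace.X r i) :=
    (QSP.SPSpace.Forms.basis_apply i).trans (QSP.SPSpace.Forms.d_X i).symm
  have h (i j : Fin 3) : QSP.SPSpace.X r i • (QSP.SPSpace.calculus r).d (QSP.SPSpace.X r j) =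
      ∑ k, (QSP.SPSpace.calculus r).d (QSP.SPSpace.X r k) <• QSP.SPSpace.leftMatrix r i k j := by
    have := QSP.SPSpace.Forms.X_smul_e (r := r) i j
    simp only [← QSP.SPSpace.Forms.d_X] at this
    exact this
  refine ⟨QSP.SPSpace.calculus r, QSP.isLeftCovariant_of_basis _ (QSP.SPSpace.Forms.basis r) hB h,
    ⟨QSP.SPSpace.Forms.basis r, hB⟩, ?_⟩
  simp only [h, QSP.SPSpace.leftMatrix, Fin.sum_univ_three, Matrix.of_apply, Matrix.cons_val,
    MulOpposite.op_zero, zero_smul, MulOpposite.op_smul, smul_assoc, add_zero, zero_add, true_and,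
    and_true]
  -- What remains is the relation for `η · dξ`, whose coefficients are grouped differently in
  -- `leftMatrix`.
  generalize (QSP.SPSpace.calculus r).d (QSP.SPSpace.X r 0) <• QSP.SPSpace.X r 2 = w02
  generalize (QSP.SPSpace.calculus r).d (QSP.SPSpace.X r 1) <• QSP.SPSpace.X r 1 = w11
  generalize (QSP.SPSpace.calculus r).d (QSP.SPSpace.X r 2) <• QSP.SPSpace.X r 0 = w20
  module
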